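/- Setting. Let $n\ge 1$ and let $\Omega\subset\mathbb{R}^n$ be a bounded open set whose boundary is of class $C^{3,a}$ for some $a\in(0,1)$. Let $\mu$ be a measure on $\Omega$ with a continuous density with respect to Lebesgue measure that is bounded away from $0$ and $\infty$. Write $L^2=L^2(\Omega,\mu)$, and let $\mathcal{H}^k$ be the space of functions in $L^2$ all of whose weak derivatives of order at most $k$ lie in $L^2$, with its usual Hilbert norm. Let $T:\mathcal{H}^1\to L^2(\partial\Omega)$ be the boundary trace operator, i.e. the continuous extension of $\varphi\mapsto\varphi|_{\partial\Omega}$ from functions that are smooth up to the boundary. The PDE. Let $\mathcal{L}$ be an operator that maps each $u\in\mathcal{H}^2$ to a measurable function on $\Omega$ (modulo null sets), with $\mathcal{L}0\in L^2$, and such that for some constant $C$ and all $u,v\in\mathcal{H}^2$, for almost every $x\in\Omega$, $$|\mathcal{L}u(x)-\mathcal{L}v(x)|\le C\Big[|u-v|(x)+\sum_{i}|\partial_{x_i}u-\partial_{x_i}v|(x)+\tfrac12\sum_{i,j}|\partial^2_{x_ix_j}u-\partial^2_{x_ix_j}v|(x)\Big].$$ Let $f$ be a boundary value in $L^2(\partial\Omega)$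 with an extension, again denoted $f$, in $\mathcal{H}^2$, whose trace is the boundary value. (No monotonicity of $\mathcal{L}$ and no existence of a solution is assumed.) The kernel. Let $\eta\in C^3_b(\mathbb{R}^n)$ satisfy $0<\eta<1$ in $\Omega$, $\eta=0$ on $\partial\Omega$, and $\nabla\eta\neq0$ at every point of $\partial\Omega$. Let $\sigma\in C^4_b(\mathbb{R})$ be non-constant. Let $c,w,b$ be independent random variables with values in $\mathbb{R},\mathbb{R}^n,\mathbb{R}$, such that $|c|<K_0$ almost surely for some constant $K_0$, $\mathbb{E}[c]=0$, $\mathbb{P}((w,b)\in U)>0$ for every non-empty open $U\subset\mathbb{R}^{n+1}$, $\mathbb{E}|w_k|^3<\infty$ for every $k$, and $\mathbb{E}|b|<\infty$. Put $$B(x,y)=\eta(x)\eta(y)\,\mathbb{E}\big[\sigma(w\cdot x+b)\sigma(w\cdot y+b)+c^2\sigma'(w\cdot x+b)\sigma'(w\cdot y+b)(x\cdot y+1)\big],\qquad(\mathcal{B}v)(y)=\int_\Omega B(x,y)v(x)\,d\mu(x).$$ The wide-network limit. Let $\alpha>0$, and let $(Q_t)_{t\ge0}$ be the solution in $\mathcal{H}^2$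 (with the time derivative taken in $\mathcal{H}^2$) of $$\frac{dQ_t}{dt}=\alpha\,\mathcal{B}\mathcal{L}(Q_t),\qquad Q_0=(1-\eta)f.$$ Theorem. Let $Q\in\mathcal{H}^2$ be a fixed point of these dynamics (that is, the constant curve $t\mapsto Q$ solves the differential equation), and suppose that $Q_t\to Q$ in $\mathcal{H}^1$ as $t\to\infty$. Then $Q$ is a strong solution of the PDE $$\mathcal{L}Q=0\ \text{ in }\Omega,\qquad Q=f\ \text{ on }\partial\Omega;$$ that is, $\mathcal{L}Q=0$ almost everywhere in $\Omega$, and the boundary trace of $Q$ is the boundary value $f$. -/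

import Mathlib

open MeasureTheory ProbabilityTheory Filter Set Topology
open scoped ENNReal NNReal ContDiff RealInnerProductSpace

noncomputable section

namespace QPDE

/-- Euclidean space `ℝⁿ`. -/
abbrev Space (n : ℕ) : Type := EuclideanSpace ℝ (Fin n)

/-- A bounded open set `Ω ⊆ ℝⁿ` with a sampling density: a continuous function on `Ω` that is
bounded away from `0` and `∞`. -/
structure SampledDomain (n : ℕ) where
  /-- the set `Ω` -/
  carrier : Set (Space n)
  isOpen : IsOpen carrier
  isBounded : Bornology.IsBounded carrier
  /-- the density `dμ/dLeb` (only its values on `Ω` matter) -/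
  density : Space n → ℝ
  continuousOn_density : ContinuousOn density carrier
  exists_bounds : ∃ m M : ℝ, 0 < m ∧ ∀ x ∈ carrier, m ≤ density x ∧ density x ≤ M

/-- Indices of partial derivatives of order at most `k`: the index `⟨m, I⟩` stands for
`∂_{I 0} ⋯ ∂_{I (m-1)}`. -/
abbrev DerivIndex (n k : ℕ) : Type := Σ m : Fin (k + 1), (Fin (m : ℕ) → Fin n)

namespace DerivIndex

/-- The index of the function itself. -/
def zero (n k : ℕ) : DerivIndex n k := ⟨⟨0, Nat.succ_pos k⟩, Fin.elim0⟩

/-- The index of `∂_i`, as an index of order at most two. -/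
def first {n : ℕ} (i : Fin n) : DerivIndex n 2 := ⟨⟨1, by norm_num⟩, fun _ => i⟩

/-- The index of `∂²_{ij}`. -/
def second {n : ℕ} (i j : Fin n) : DerivIndex n 2 := ⟨⟨2, by norm_num⟩, ![i, j]⟩

/-- An index of order at most `j`, seen as one of order at most `k`. -/
def castLE {n j k : ℕ} (h : j ≤ k) (a : DerivIndex n j) : DerivIndex n k :=
  ⟨Fin.castLE (Nat.succ_le_succ h) a.1, a.2⟩

end DerivIndex

/-- The classical partial derivative `∂_{I 0} ⋯ ∂_{I (m-1)} φ (x)`. -/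
def partialDeriv {n m : ℕ} (I : Fin m → Fin n) (φ : Space n → ℝ) (x : Space n) : ℝ :=
  iteratedFDeriv ℝ m φ x (fun j => EuclideanSpace.single (I j) (1 : ℝ))

/-- `v` is the weak derivative `∂_{I 0} ⋯ ∂_{I (m-1)} u` on the set `Ω`. -/
def HasWeakDeriv {n m : ℕ} (Ω : Set (Space n)) (I : Fin m → Fin n) (u v : Space n → ℝ) : Prop :=
  ∀ φ : Space n → ℝ, ContDiff ℝ ∞ φ → HasCompactSupport φ → tsupport φ ⊆ Ω →
    ∫ x in Ω, u x * partialDeriv I φ x = (-1) ^ m * ∫ x in Ω, v x * φ x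

/-- `g ∈ C^k_b`: `g` is `k` times continuously differentiable, and `g` and its derivatives up to
order `k` are bounded. -/
def IsCb {F : Type*} [NormedAddCommGroup F] [NormedSpace ℝ F] (k : ℕ) (g : F → ℝ) : Prop :=
  ContDiff ℝ k g ∧ ∀ m ≤ k, ∃ C : ℝ, ∀ x, ‖iteratedFDeriv ℝ m g x‖ ≤ C

/-- The boundary of `Ω` is of class `C^{k,a}`: near each boundary point, `Ω` is, in suitable
orthonormal coordinates, the region strictly above the graph of a `C^{k,a}` function. -/
def HasHolderBoundary {n : ℕ} (Ω : Set (Space n)) (k : ℕ) (a : ℝ≥0) : Prop :=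
  ∀ x₀ ∈ frontier Ω, ∃ r > 0, ∃ ν : Space n, ‖ν‖ = 1 ∧ ∃ γ : (ℝ ∙ ν)ᗮ → ℝ,
    ContDiff ℝ k γ ∧ (∃ C : ℝ≥0, HolderWith C a (iteratedFDeriv ℝ k γ)) ∧
    Ω ∩ Metric.ball x₀ r =
      {x | x ∈ Metric.ball x₀ r ∧ γ ((ℝ ∙ ν)ᗮ.orthogonalProjectionOnto x) < ⟪ν, x⟫}

namespace SampledDomain

variable {n : ℕ} (D : SampledDomain n)

/-- The sampling measure `μ` on `Ω`. -/
def μ : Measure (Space n) :=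
  (volume.restrict D.carrier).withDensity (fun x => ENNReal.ofReal (D.density x))

/-- The surface measure on `∂Ω`. -/
def surface : Measure (Space n) := (μH[(n : ℝ) - 1]).restrict (frontier D.carrier)

theorem smul_volume_le : ∃ c : ℝ≥0∞, c ≠ ⊤ ∧ volume.restrict D.carrier ≤ c • D.μ := by
  obtain ⟨m, M, hm, hb⟩ := D.exists_bounds
  refine ⟨(ENNReal.ofReal m)⁻¹, by simp [hm], ?_⟩
  refine Measure.le_iff.2 fun s hs => ?_
  have h1 : ENNReal.ofReal m * volume.restrict D.carrier s ≤ D.μ s := by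
    rw [μ, withDensity_apply _ hs, ← setLIntegral_const]
    refine lintegral_mono_ae ?_
    refine ae_restrict_of_ae ?_
    filter_upwards [ae_restrict_mem D.isOpen.measurableSet] with x hx
    exact ENNReal.ofReal_le_ofReal (hb x hx).1
  rw [Measure.smul_apply, smul_eq_mul, mul_comm, ← div_eq_mul_inv,
    ENNReal.le_div_iff_mul_le (Or.inl (by simp [hm])) (Or.inl (by simp)), mul_comm]
  exact h1

theorem ae_volume_of_ae {p : Space n → Prop} (h : ∀ᵐ x ∂D.μ, p x) :
    ∀ᵐ x ∂volume.restrict D.carrier, p x := by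
  obtain ⟨c, -, hle⟩ := D.smul_volume_le
  exact (Measure.absolutelyContinuous_of_le_smul hle).ae_le h

theorem memLp_volume (u : Lp ℝ 2 D.μ) : MemLp u 2 (volume.restrict D.carrier) := by
  obtain ⟨c, hc, hle⟩ := D.smul_volume_le
  exact (Lp.memLp u).of_measure_le_smul hc hle

theorem integrable_mul (u : Lp ℝ 2 D.μ) {g : Space n → ℝ} (hg : Continuous g)
    (hg' : HasCompactSupport g) :
    Integrable (fun x => u x * g x) (volume.restrict D.carrier) :=
  MemLp.integrable_mul (p := 2) (q := 2) (D.memLp_volume u)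
    ((hg.memLp_of_hasCompactSupport hg').restrict _)

theorem continuous_partialDeriv {m : ℕ} (I : Fin m → Fin n) {φ : Space n → ℝ}
    (h : ContDiff ℝ ∞ φ) : Continuous (partialDeriv I φ) := by
  have := h.continuous_iteratedFDeriv (m := m) (by exact_mod_cast le_top)
  exact (ContinuousMultilinearMap.apply ℝ _ ℝ _).continuous.comp this

theorem hasCompactSupport_partialDeriv {m : ℕ} (I : Fin m → Fin n) {φ : Space n → ℝ}
    (h : HasCompactSupport φ) : HasCompactSupport (partialDeriv I φ) := by
  have := (h.iteratedFDeriv (𝕜 := ℝ) m).comp_left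
    (g := fun T : ContinuousMultilinearMap ℝ (fun _ : Fin m => Space n) ℝ =>
      T (fun j => EuclideanSpace.single (I j) (1 : ℝ))) rfl
  exact this

/-- The Sobolev space `𝓗^k(Ω, μ)` of functions in `L²(μ)` whose weak derivatives of order at most
`k` are in `L²(μ)`. A function is stored with all its weak derivatives, so that the norm inherited
from the `ℓ²`-product is `‖u‖² = ∑ ‖D^α u‖²_{L²(μ)}`. -/
def sobolev (k : ℕ) : Submodule ℝ (PiLp 2 (fun _ : DerivIndex n k => Lp ℝ 2 D.μ)) where
  carrier := {U | ∀ a : DerivIndex n k,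
    HasWeakDeriv D.carrier a.2 (U (DerivIndex.zero n k)) (U a)}
  zero_mem' := by
    intro a φ h1 h2 h3
    have h0 := D.ae_volume_of_ae (Lp.coeFn_zero ℝ 2 D.μ)
    have e1 : ∀ g : Space n → ℝ,
        ∫ x in D.carrier, (0 : Lp ℝ 2 D.μ) x * g x = 0 := by
      intro g
      refine integral_eq_zero_of_ae ?_
      filter_upwards [h0] with x hx
      rw [hx, Pi.zero_apply, zero_mul]
    simp only [PiLp.zero_apply, e1, mul_zero]
  add_mem' := by
    intro U V hU hV a φ h1 h2 h3
    have e1 : ∀ (b : DerivIndex n k) (g : Space n → ℝ), Continuous g → HasCompactSupport g →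
        ∫ x in D.carrier, ((U + V) b) x * g x =
          (∫ x in D.carrier, U b x * g x) + ∫ x in D.carrier, V b x * g x := by
      intro b g hg hg'
      rw [← integral_add (D.integrable_mul _ hg hg') (D.integrable_mul _ hg hg')]
      refine integral_congr_ae ?_
      filter_upwards [D.ae_volume_of_ae (Lp.coeFn_add (U b) (V b))] with x hx
      rw [PiLp.add_apply, hx, Pi.add_apply, add_mul]
    rw [e1 _ _ (continuous_partialDeriv a.2 h1) (hasCompactSupport_partialDeriv a.2 h2),
      e1 _ _ h1.continuous h2, hU a φ h1 h2 h3, hV a φ h1 h2 h3, mul_add]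
  smul_mem' := by
    intro c U hU a φ h1 h2 h3
    have e1 : ∀ (b : DerivIndex n k) (g : Space n → ℝ),
        ∫ x in D.carrier, ((c • U) b) x * g x = c * ∫ x in D.carrier, U b x * g x := by
      intro b g
      rw [← integral_const_mul]
      refine integral_congr_ae ?_
      filter_upwards [D.ae_volume_of_ae (Lp.coeFn_smul c (U b))] with x hx
      rw [PiLp.smul_apply, hx, Pi.smul_apply, smul_eq_mul, mul_assoc]
    rw [e1, e1, hU a φ h1 h2 h3]
    ring

variable {D}

/-- The weak derivative of `u` with index `a`, as an element of `L²(μ)`. -/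
def weakDeriv {k : ℕ} (u : D.sobolev k) (a : DerivIndex n k) : Lp ℝ 2 D.μ := u.1 a

/-- The element of `L²(μ)` underlying a Sobolev function. -/
def toL2 {k : ℕ} (u : D.sobolev k) : Lp ℝ 2 D.μ := weakDeriv u (DerivIndex.zero n k)

/-- The inclusion `𝓗² ⊆ 𝓗¹`. -/
def toH1 (u : D.sobolev 2) : D.sobolev 1 :=
  ⟨WithLp.toLp 2 (fun a => weakDeriv u (a.castLE one_le_two)),
    fun a => u.2 (a.castLE one_le_two)⟩

/-- `g` is the boundary trace of `u ∈ 𝓗¹(Ω)`: the boundary trace operator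
`T : 𝓗¹(Ω) → L²(∂Ω)` is the continuous extension of `φ ↦ φ|_{∂Ω}` from the functions `φ` that are
smooth up to the boundary, so that `T u = g` in `L²(∂Ω)` means that smooth `φ_j` converge to `u` in
`𝓗¹(Ω)` while their restrictions `φ_j|_{∂Ω}` converge to `g` in `L²(∂Ω)`. -/
def HasTrace (u : D.sobolev 1) (g : Space n → ℝ) : Prop :=
  MemLp g 2 D.surface ∧ ∃ φ : ℕ → Space n → ℝ, (∀ j, ContDiff ℝ ∞ (φ j)) ∧
    (∀ a : DerivIndex n 1, Tendsto
      (fun j => eLpNorm (fun x => partialDeriv a.2 (φ j) x - weakDeriv u a x) 2 D.μ)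
      atTop (𝓝 0)) ∧
    Tendsto (fun j => eLpNorm (fun x => φ j x - g x) 2 D.surface) atTop (𝓝 0)

/-- The pointwise Lipschitz condition on a (nonlinear, second-order) operator `L` on `𝓗²`. -/
def IsLipschitzOperator (L : D.sobolev 2 → (Space n →ₘ[D.μ] ℝ)) : Prop :=
  ∃ C : ℝ, ∀ u v : D.sobolev 2, ∀ᵐ x ∂D.μ,
    |L u x - L v x| ≤ C * (|toL2 u x - toL2 v x|
      + ∑ i, |weakDeriv u (.first i) x - weakDeriv v (.first i) x|
      + 1 / 2 * ∑ i, ∑ j, |weakDeriv u (.second i j) x - weakDeriv v (.second i j) x|)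

/-- `u ∈ 𝓗²` is a strong Sobolev solution of `L u = 0` in `Ω`, `u = g` on `∂Ω`. -/
def IsSolution (L : D.sobolev 2 → (Space n →ₘ[D.μ] ℝ)) (g : Space n → ℝ)
    (u : D.sobolev 2) : Prop :=
  (∀ᵐ x ∂D.μ, L u x = 0) ∧ HasTrace (toH1 u) g

variable (D)

/-- `η` is an auxiliary function for `Ω`. -/
structure IsAuxiliary (η : Space n → ℝ) : Prop where
  smooth : IsCb 3 η
  mem_Ioo : ∀ x ∈ D.carrier, 0 < η x ∧ η x < 1
  eq_zero : ∀ x ∈ frontier D.carrier, η x = 0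
  fderiv_ne_zero : ∀ x ∈ frontier D.carrier, fderiv ℝ η x ≠ 0

end SampledDomain

/-- The activation function is in `C⁴_b(ℝ)` and is not constant. -/
structure IsActivation (σ : ℝ → ℝ) : Prop where
  smooth : IsCb 4 σ
  nonconstant : ¬ ∃ a, ∀ x, σ x = a

/-- The assumptions on the random initialization `(c, w, b)` of one hidden unit. -/
structure IsInitialization {n : ℕ} {S : Type*} [MeasurableSpace S] (P : Measure S)
    (c : S → ℝ) (w : S → Space n) (b : S → ℝ) : Prop where
  measurable_c : Measurable c
  measurable_w : Measurable w
  measurable_b : Measurable b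
  /-- the next two fields say that `c`, `w`, `b` are (mutually) independent -/
  indep_c : IndepFun c (fun s => (w s, b s)) P
  indep_wb : IndepFun w b P
  bounded_c : ∃ K : ℝ, ∀ᵐ s ∂P, |c s| < K
  mean_c : ∫ s, c s ∂P = 0
  full_support : ∀ U : Set (Space n × ℝ), IsOpen U → U.Nonempty → 0 < P {s | (w s, b s) ∈ U}
  moment_w : ∀ k, Integrable (fun s => |w s k| ^ 3) P
  moment_b : Integrable b P

/-- The limit neural tangent kernel `A(x, y)`. -/
def kernelA {n : ℕ} {S : Type*} [MeasurableSpace S] (P : Measure S) (σ : ℝ → ℝ)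
    (c : S → ℝ) (w : S → Space n) (b : S → ℝ) (x y : Space n) : ℝ :=
  ∫ s, (σ (⟪w s, x⟫ + b s) * σ (⟪w s, y⟫ + b s)
    + c s ^ 2 * deriv σ (⟪w s, x⟫ + b s) * deriv σ (⟪w s, y⟫ + b s) * (⟪x, y⟫ + 1)) ∂P

/-- The kernel `B(x, y) = η(x) η(y) A(x, y)`. -/
def kernelB {n : ℕ} {S : Type*} [MeasurableSpace S] (P : Measure S) (σ : ℝ → ℝ)
    (c : S → ℝ) (w : S → Space n) (b : S → ℝ) (η : Space n → ℝ) (x y : Space n) : ℝ :=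
  η x * η y * kernelA P σ c w b x y

namespace SampledDomain

variable {n : ℕ} (D : SampledDomain n)

/-- The integral operator `(𝓑 v)(y) = ∫_Ω B(x, y) v(x) dμ(x)` with kernel `B`. -/
def integralOp (B : Space n → Space n → ℝ) (v : Space n → ℝ) (y : Space n) : ℝ :=
  ∫ x, B x y * v x ∂D.μ

variable {D}

/-- `Q : [0, ∞) → 𝓗²` solves `dQ_t/dt = α 𝓑 L(Q_t)`, the derivative being taken in `𝓗²`
(one-sided at `t = 0`). -/
def SolvesLimitODE (α : ℝ) (B : Space n → Space n → ℝ)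
    (L : D.sobolev 2 → (Space n →ₘ[D.μ] ℝ)) (Q : ℝ → D.sobolev 2) : Prop :=
  ∀ t : ℝ, 0 ≤ t → ∃ Q' : D.sobolev 2, HasDerivWithinAt Q Q' (Ici 0) t ∧
    ∀ᵐ y ∂D.μ, toL2 Q' y = α * D.integralOp B (L (Q t)) y

/-- The wide network limit: the solution of the limit ODE that starts at `Q_0 = (1 - η) f`. -/
def IsWideNetworkLimit (α : ℝ) (B : Space n → Space n → ℝ)
    (L : D.sobolev 2 → (Space n →ₘ[D.μ] ℝ)) (η : Space n → ℝ) (f : D.sobolev 2)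
    (Q : ℝ → D.sobolev 2) : Prop :=
  (∀ᵐ y ∂D.μ, toL2 (Q 0) y = (1 - η y) * toL2 f y) ∧ SolvesLimitODE α B L Q

/-- `q ∈ 𝓗²` is a fixed point of the limit dynamics: the constant curve `q` solves the ODE. -/
def IsFixedPoint (α : ℝ) (B : Space n → Space n → ℝ)
    (L : D.sobolev 2 → (Space n →ₘ[D.μ] ℝ)) (q : D.sobolev 2) : Prop :=
  SolvesLimitODE α B L (fun _ => q)

end SampledDomain

end QPDE

end

/-!
The equation `L Q = 0` and the boundary condition come from two independent arguments.

*The equation.* At a fixed point `𝓑(L Q) = 0`. The Lipschitz condition puts `L Q` in `L²(μ)`. With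
`h = η · L Q`, Fubini's theorem turns `⟨L Q, 𝓑(L Q)⟩ = 0` into the vanishing of an average of squares
over `(c, w, b)` (`integral_mul_integral_kernelA`), one of which is `(∫ h(x) σ(w · x + b) dμ)²`.
Since this integral is continuous in `(w, b)` and the law of `(w, b)` has full support, it vanishes
for all `(w, b)`. A bounded non-constant `σ` is discriminatory
(`ae_eq_zero_of_forall_integral_mul_ridge_eq_zero`), so `h = 0`, and `L Q = 0` because `η > 0` on
`Ω`. The discriminatory property is proved by mollifying `σ` to a smooth function `G` all of whose
derivatives are bounded, and not identically zero since a bounded non-constant function is not a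
polynomial. Differentiating `∫ h(x) G(λ u · x + θ) dμ = 0` in `λ` at `λ = 0` shows that all moments
`∫ h(x) (u · x)^k dμ` vanish; as `Ω` is bounded, so does the Fourier transform of `h μ`.

*The boundary condition.* The relation `T u = g` with `g` fixed is closed in `𝓗¹`
(`HasTrace.of_tendsto`), so it suffices that every `Q_t` has trace `f`. This holds at `t = 0`,
because `1 - η = 1` on the boundary (`HasTrace.mul_of_eq_one`), and the velocity `α 𝓑(L Q_t)` is `η` times a
`C¹` function, hence has zero trace; since the functions with zero trace form a closed subspace of
`𝓗¹`, the curve stays in a single coset (`HasTrace.of_hasDerivWithinAt`). The functions at hand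
are only `C¹`, whereas the trace is defined by smooth approximations:
`hasTrace_of_contDiff_one_approx` bridges the gap by mollification, for which the surface measure of
the boundary must be finite (`HasHolderBoundary.hausdorffMeasure_frontier_lt_top`), and identifies
limits of classical derivatives with weak derivatives.
-/

noncomputable section

namespace QPDE

/-! ### Bounded non-constant activations are discriminatory -/

section Mollification

/-- The mollification `s ↦ ∫ ρ t σ (s - t) dt` of `σ` by `ρ`. -/
def mollify (ρ σ : ℝ → ℝ) : ℝ → ℝ :=
  convolution ρ σ (ContinuousLinearMap.lsmul ℝ ℝ) volume

theorem mollify_apply (ρ σ : ℝ → ℝ) (s : ℝ) : mollify ρ σ s = ∫ t, ρ t * σ (s - t) := rfl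

variable {ρ σ : ℝ → ℝ} {C : ℝ}

theorem abs_mollify_le (hρ : Continuous ρ) (hρ' : HasCompactSupport ρ)
    (hC : ∀ x, |σ x| ≤ C) (s : ℝ) : |mollify ρ σ s| ≤ C * ∫ t, |ρ t| := by
  rw [mollify_apply, ← integral_const_mul]
  refine (abs_integral_le_integral_abs).trans ?_
  refine integral_mono_of_nonneg (.of_forall fun t => abs_nonneg _)
    (((hρ.integrable_of_hasCompactSupport hρ').abs).const_mul C) (.of_forall fun t => ?_)
  simp only [abs_mul]
  rw [mul_comm]
  exact mul_le_mul_of_nonneg_right (hC _) (abs_nonneg _)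

theorem hasDerivAt_mollify (hρ : ContDiff ℝ ∞ ρ) (hρ' : HasCompactSupport ρ)
    (hσ : Continuous σ) (s : ℝ) : HasDerivAt (mollify ρ σ) (mollify (deriv ρ) σ s) s :=
  hρ'.hasDerivAt_convolution_left _ (hρ.of_le (by exact_mod_cast le_top))
    hσ.locallyIntegrable s

theorem continuous_mollify (hρ : ContDiff ℝ ∞ ρ) (hρ' : HasCompactSupport ρ)
    (hσ : Continuous σ) : Continuous (mollify ρ σ) :=
  continuous_iff_continuousAt.2 fun s => (hasDerivAt_mollify hρ hρ' hσ s).continuousAt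

theorem hasCompactSupport_deriv_iterate (hρ : HasCompactSupport ρ) (k : ℕ) :
    HasCompactSupport (deriv^[k] ρ) := by
  induction k with
  | zero => exact hρ
  | succ k ih => rw [Function.iterate_succ_apply']; exact ih.deriv

/-- A bounded function whose derivative is constant has zero derivative. -/
theorem eq_zero_of_bounded_of_hasDerivAt_const {f : ℝ → ℝ} {c : ℝ}
    (hf : ∀ x, HasDerivAt f c x) (hb : ∀ x, |f x| ≤ C) : c = 0 := by
  have h1 : ∀ x, f x = f 0 + c * x := by
    intro x
    have h := is_const_of_deriv_eq_zero (f := fun x => f x - c * x)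
      (fun x => ((hf x).sub ((hasDerivAt_id x).const_mul c)).differentiableAt)
      (fun x => (((hf x).sub ((hasDerivAt_id x).const_mul c)).congr_deriv (by simp)).deriv) x 0
    simp only [mul_zero, sub_zero] at h
    linarith
  by_contra hc
  have h2 := hb ((2 * C + 1) / c)
  rw [h1, mul_div_cancel₀ _ hc] at h2
  have h3 := hb 0
  rw [abs_le] at h2 h3
  linarith

theorem exists_mollify_deriv_iterate_ne_zero (hρ : ContDiff ℝ ∞ ρ) (hρ' : HasCompactSupport ρ)
    (hσ : Continuous σ) (hC : ∀ x, |σ x| ≤ C) (hne : ¬ ∃ a, ∀ x, mollify ρ σ x = a) (k : ℕ) :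
    ∃ θ, mollify (deriv^[k] ρ) σ θ ≠ 0 := by
  by_contra! h
  have hd : ∀ k s, HasDerivAt (mollify (deriv^[k] ρ) σ) (mollify (deriv^[k + 1] ρ) σ s) s := by
    intro k s
    rw [Function.iterate_succ_apply']
    exact hasDerivAt_mollify (hρ.iterate_deriv k) (hasCompactSupport_deriv_iterate hρ' k)
      hσ s
  have key : ∀ k, (∀ θ, mollify (deriv^[k] ρ) σ θ = 0) → ∃ a, ∀ x, mollify ρ σ x = a := by
    intro k
    induction k with
    | zero => exact fun h => ⟨0, h⟩
    | succ k ih =>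
      intro h
      have hconst := fun x => is_const_of_deriv_eq_zero
        (fun s => (hd k s).differentiableAt) (fun s => (hd k s).deriv.trans (h s)) x 0
      rcases k with _ | k
      · exact ⟨_, hconst⟩
      · have h0 := eq_zero_of_bounded_of_hasDerivAt_const
          (f := mollify (deriv^[k] ρ) σ) (c := mollify (deriv^[k + 1] ρ) σ 0)
          (fun x => hconst x ▸ hd k x)
          (abs_mollify_le (hρ.iterate_deriv k).continuous
            (hasCompactSupport_deriv_iterate hρ' k) hC)
        exact ih fun θ => (hconst θ).trans h0
  exact hne (key k h)

/-- Some mollification of a non-constant continuous function is non-constant, because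
mollifications by shrinking bump functions converge to the function pointwise. -/
theorem exists_mollify_nonconstant (hσ : Continuous σ) (hne : ¬ ∃ a, ∀ x, σ x = a) :
    ∃ ρ : ℝ → ℝ, ContDiff ℝ ∞ ρ ∧ HasCompactSupport ρ ∧ ¬ ∃ a, ∀ x, mollify ρ σ x = a := by
  by_contra! h
  let φ : ℕ → ContDiffBump (0 : ℝ) := fun j =>
    ⟨1 / (j + 1 : ℝ) / 2, 1 / (j + 1 : ℝ), by positivity, half_lt_self (by positivity)⟩
  have hφ : Tendsto (fun j => (φ j).rOut) atTop (𝓝 0) := tendsto_one_div_add_atTop_nhds_zero_nat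
  have hlim := ContDiffBump.convolution_tendsto_right_of_continuous (μ := volume) hφ hσ
  refine hne ⟨σ 0, fun x => tendsto_nhds_unique (hlim x) ((hlim 0).congr fun j => ?_)⟩
  obtain ⟨a, ha⟩ := h ((φ j).normed volume) (φ j).contDiff_normed
    (φ j).hasCompactSupport_normed
  exact (ha 0).trans (ha x).symm

end Mollification

section Discriminatory

variable {E : Type*} [NormedAddCommGroup E] [InnerProductSpace ℝ E] [MeasurableSpace E]
  [BorelSpace E] {ν : Measure E} {h : E → ℝ} {σ : ℝ → ℝ} {C R : ℝ}

theorem integral_mul_mollify_eq_zero [SFinite ν] (hh : Integrable h ν) (hσ : Continuous σ)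
    (hC : ∀ x, |σ x| ≤ C) (h0 : ∀ (w : E) (b : ℝ), ∫ x, h x * σ (⟪w, x⟫ + b) ∂ν = 0)
    {ρ : ℝ → ℝ} (hρ : Continuous ρ) (hρ' : HasCompactSupport ρ) (w : E) (b : ℝ) :
    ∫ x, h x * mollify ρ σ (⟪w, x⟫ + b) ∂ν = 0 := by
  have hint : Integrable (Function.uncurry fun (x : E) (t : ℝ) =>
      h x * (ρ t * σ (⟪w, x⟫ + b - t))) (ν.prod volume) := by
    have h1 := (hh.mul_prod
      (hρ.integrable_of_hasCompactSupport hρ' (μ := volume))).mul_bdd (c := C)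
      (g := fun z : E × ℝ => σ (⟪w, z.1⟫ + b - z.2))
      (Continuous.aestronglyMeasurable (by fun_prop)) (.of_forall fun z => hC _)
    exact h1.congr (.of_forall fun z => mul_assoc _ _ _)
  simp only [mollify_apply, ← integral_const_mul]
  rw [integral_integral_swap hint]
  refine integral_eq_zero_of_ae (.of_forall fun t => ?_)
  have h2 := h0 w (b - t)
  simp only [Pi.zero_apply]
  rw [← mul_zero (ρ t), ← h2, ← integral_const_mul]
  congr 1 with x
  rw [add_sub_assoc]
  ring

/-- Differentiating `∫ h(x) G(λ ⟪u, x⟫ + θ) dν = 0` repeatedly in `λ`, where `G` is a mollification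
of `σ`; `l` stands for `λ`. -/
theorem integral_mul_inner_pow_mul_mollify_eq_zero
    [SecondCountableTopology E] [SFinite ν] (hh : Integrable h ν)
    (hR : ∀ᵐ x ∂ν, ‖x‖ ≤ R) (hσ : Continuous σ) (hC : ∀ x, |σ x| ≤ C)
    (h0 : ∀ (w : E) (b : ℝ), ∫ x, h x * σ (⟪w, x⟫ + b) ∂ν = 0)
    {ρ : ℝ → ℝ} (hρ : ContDiff ℝ ∞ ρ) (hρ' : HasCompactSupport ρ) (u : E) (θ : ℝ) (k : ℕ) (l : ℝ) :
    ∫ x, h x * ⟪u, x⟫ ^ k * mollify (deriv^[k] ρ) σ (l * ⟪u, x⟫ + θ) ∂ν = 0 := by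
  induction k generalizing l with
  | zero =>
    simpa [inner_smul_left] using
      integral_mul_mollify_eq_zero hh hσ hC h0 hρ.continuous hρ' (l • u) θ
  | succ k ih =>
    have hc : ∀ k, Continuous (mollify (deriv^[k] ρ) σ) := fun k =>
      continuous_mollify (hρ.iterate_deriv k) (hasCompactSupport_deriv_iterate hρ' k) hσ
    have hb : ∀ k, ∃ M, ∀ s, |mollify (deriv^[k] ρ) σ s| ≤ M := fun k =>
      ⟨_, abs_mollify_le (hρ.iterate_deriv k).continuous
        (hasCompactSupport_deriv_iterate hρ' k) hC⟩
    have hp : ∀ k, Integrable (fun x => h x * ⟪u, x⟫ ^ k) ν := by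
      intro k
      refine hh.mul_bdd (c := (‖u‖ * R) ^ k) (Continuous.aestronglyMeasurable (by fun_prop)) ?_
      filter_upwards [hR] with x hx
      rw [norm_pow]
      refine pow_le_pow_left₀ (norm_nonneg _) ((norm_inner_le_norm u x).trans ?_) k
      gcongr
    obtain ⟨M, hM⟩ := hb (k + 1)
    obtain ⟨M₀, hM₀⟩ := hb k
    have hd := (hasDerivAt_integral_of_dominated_loc_of_deriv_le (μ := ν) (x₀ := l) (s := univ)
      (F := fun l x => h x * ⟪u, x⟫ ^ k * mollify (deriv^[k] ρ) σ (l * ⟪u, x⟫ + θ))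
      (F' := fun l x => h x * ⟪u, x⟫ ^ (k + 1) * mollify (deriv^[k + 1] ρ) σ (l * ⟪u, x⟫ + θ))
      (bound := fun x => ‖h x * ⟪u, x⟫ ^ (k + 1)‖ * M) univ_mem
      (.of_forall fun l => (hp k).aestronglyMeasurable.mul
        ((hc k).comp (by fun_prop)).aestronglyMeasurable)
      ((hp k).mul_bdd (c := M₀) ((hc k).comp (by fun_prop)).aestronglyMeasurable
        (.of_forall fun x => hM₀ _))
      ((hp _).aestronglyMeasurable.mul ((hc _).comp (by fun_prop)).aestronglyMeasurable)
      (.of_forall fun x l _ => ?_) ((hp _).norm.mul_const M) (.of_forall fun x l _ => ?_)).2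
    · rw [← hd.deriv, funext ih]
      simp
    · rw [norm_mul]
      exact mul_le_mul_of_nonneg_left (hM _) (norm_nonneg _)
    · have h1 : HasDerivAt (mollify (deriv^[k] ρ) σ)
          (mollify (deriv^[k + 1] ρ) σ (l * ⟪u, x⟫ + θ)) (l * ⟪u, x⟫ + θ) := by
        rw [Function.iterate_succ_apply']
        exact hasDerivAt_mollify (hρ.iterate_deriv k)
          (hasCompactSupport_deriv_iterate hρ' k) hσ _
      have h2 : HasDerivAt (fun l : ℝ => l * ⟪u, x⟫ + θ) ⟪u, x⟫ l := by
        simpa using ((hasDerivAt_id l).mul_const ⟪u, x⟫).add_const θ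
      refine ((h1.comp l h2).const_mul (h x * ⟪u, x⟫ ^ k)).congr_deriv ?_
      rw [pow_succ]
      ring

theorem integral_mul_inner_pow_eq_zero
    [SecondCountableTopology E] [SFinite ν] (hh : Integrable h ν)
    (hR : ∀ᵐ x ∂ν, ‖x‖ ≤ R) (hσ : Continuous σ) (hC : ∀ x, |σ x| ≤ C)
    (hne : ¬ ∃ a, ∀ x, σ x = a)
    (h0 : ∀ (w : E) (b : ℝ), ∫ x, h x * σ (⟪w, x⟫ + b) ∂ν = 0) (u : E) (k : ℕ) :
    ∫ x, h x * ⟪u, x⟫ ^ k ∂ν = 0 := by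
  obtain ⟨ρ, hρ, hρ', hρne⟩ := exists_mollify_nonconstant hσ hne
  obtain ⟨θ, hθ⟩ := exists_mollify_deriv_iterate_ne_zero hρ hρ' hσ hC hρne k
  -- At `l = 0` the mollification leaves the integral as a non-zero constant.
  have h1 := integral_mul_inner_pow_mul_mollify_eq_zero hh hR hσ hC h0 hρ hρ' u θ k 0
  simp only [zero_mul, zero_add, integral_mul_const] at h1
  exact (mul_eq_zero.1 h1).resolve_right hθ

/-- The exponential series turns vanishing moments into a vanishing Fourier transform. -/
theorem integral_mul_cexp_eq_zero (hh : Integrable h ν) (hR : ∀ᵐ x ∂ν, ‖x‖ ≤ R)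
    (h0 : ∀ (u : E) (k : ℕ), ∫ x, h x * ⟪u, x⟫ ^ k ∂ν = 0) (u : E) :
    ∫ x, (h x : ℂ) * Complex.exp (⟪u, x⟫ * Complex.I) ∂ν = 0 := by
  have hs := hasSum_integral_of_dominated_convergence (μ := ν)
    (F := fun (k : ℕ) x => (h x : ℂ) * ((⟪u, x⟫ * Complex.I) ^ k / k.factorial))
    (f := fun x => (h x : ℂ) * Complex.exp (⟪u, x⟫ * Complex.I))
    (fun k x => |h x| * ((‖u‖ * R) ^ k / k.factorial))
    (fun k => (Complex.continuous_ofReal.comp_aestronglyMeasurable hh.aestronglyMeasurable).mul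
      (Continuous.aestronglyMeasurable (by fun_prop)))
    (fun k => ?_) (.of_forall fun x => (Real.summable_pow_div_factorial _).mul_left _) ?_
    (.of_forall fun x => ?_)
  · refine hs.unique ?_
    convert hasSum_zero with k
    have h1 : ∀ x, (h x : ℂ) * ((⟪u, x⟫ * Complex.I) ^ k / k.factorial) =
        ((h x * ⟪u, x⟫ ^ k : ℝ) : ℂ) * (Complex.I ^ k / k.factorial) := by
      intro x
      push_cast
      rw [mul_pow]
      ring
    simp_rw [h1]
    rw [integral_mul_const, integral_complex_ofReal, h0 u k]
    simp
  · filter_upwards [hR] with x hx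
    simp only [norm_mul, Complex.norm_real, norm_div, norm_pow, Complex.norm_I, mul_one,
      Complex.norm_natCast, Real.norm_eq_abs]
    have h2 : |⟪u, x⟫| ≤ ‖u‖ * R := (abs_real_inner_le_norm u x).trans (by gcongr)
    gcongr
  · simp_rw [tsum_mul_left]
    exact hh.abs.mul_const _
  · refine HasSum.mul_left _ ?_
    rw [Complex.exp_eq_exp_ℂ]
    exact NormedSpace.expSeries_div_hasSum_exp _

/-- An integrable function on a Hilbert space whose Fourier transform vanishes is zero almost
everywhere: its positive and its negative part have the same
characteristic function. -/
theorem ae_eq_zero_of_integral_mul_cexp_eq_zero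
    [SecondCountableTopology E] [CompleteSpace E] (hh : Integrable h ν)
    (h0 : ∀ u : E, ∫ x, (h x : ℂ) * Complex.exp (⟪u, x⟫ * Complex.I) ∂ν = 0) : h =ᵐ[ν] 0 := by
  have hp := hh.aemeasurable.ennreal_ofReal
  have hm := hh.neg.aemeasurable.ennreal_ofReal
  have hpf : ∫⁻ x, ENNReal.ofReal (h x) ∂ν ≠ ⊤ := hh.lintegral_lt_top.ne
  have hmf : ∫⁻ x, ENNReal.ofReal ((-h) x) ∂ν ≠ ⊤ := hh.neg.lintegral_lt_top.ne
  have := isFiniteMeasure_withDensity hpf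
  have := isFiniteMeasure_withDensity hmf
  have heq : ν.withDensity (fun x => ENNReal.ofReal (h x)) =
      ν.withDensity (fun x => ENNReal.ofReal ((-h) x)) := by
    refine Measure.ext_of_charFun (funext fun u => ?_)
    have hint : ∀ g : E → ℝ, Integrable g ν →
        Integrable (fun x => (max (g x) 0) • Complex.exp (⟪x, u⟫ * Complex.I)) ν := by
      intro g hg
      have h1 : Integrable (fun x => max (g x) 0) ν := hg.pos_part
      refine (h1.ofReal (𝕜 := ℂ)).mul_bdd (c := 1) (g := fun x => Complex.exp (⟪x, u⟫ * Complex.I))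
        (Continuous.aestronglyMeasurable (by fun_prop))
        (.of_forall fun x => (Complex.norm_exp_ofReal_mul_I _).le) |>.congr (.of_forall fun x => ?_)
      simp
    rw [charFun_apply, charFun_apply, integral_withDensity_eq_integral_toReal_smul₀ hp (by simp),
      integral_withDensity_eq_integral_toReal_smul₀ hm (by simp), ← sub_eq_zero]
    simp only [ENNReal.toReal_ofReal']
    rw [← integral_sub (hint h hh) (hint (-h) hh.neg), ← h0 u]
    congr 1 with x
    rw [← sub_smul, real_inner_comm, ← Complex.real_smul]
    congr 1
    rcases le_total 0 (h x) with hx | hx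
    · simp [hx]
    · simp [hx]
  have h1 := (withDensity_eq_iff hp hm hpf).1 heq
  filter_upwards [h1] with x hx
  simp only [Pi.neg_apply, Pi.zero_apply] at hx ⊢
  rcases le_total 0 (h x) with h2 | h2
  · rw [ENNReal.ofReal_of_nonpos (neg_nonpos.2 h2), ENNReal.ofReal_eq_zero] at hx
    exact le_antisymm hx h2
  · rw [ENNReal.ofReal_of_nonpos h2, eq_comm, ENNReal.ofReal_eq_zero] at hx
    linarith

/-- A bounded non-constant continuous function `σ` is discriminatory for signed measures of bounded
support. -/
theorem ae_eq_zero_of_forall_integral_mul_ridge_eq_zero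
    [SecondCountableTopology E] [CompleteSpace E] [SFinite ν]
    (hh : Integrable h ν) (hR : ∀ᵐ x ∂ν, ‖x‖ ≤ R) (hσ : Continuous σ) (hC : ∀ x, |σ x| ≤ C)
    (hne : ¬ ∃ a, ∀ x, σ x = a)
    (h0 : ∀ (w : E) (b : ℝ), ∫ x, h x * σ (⟪w, x⟫ + b) ∂ν = 0) : h =ᵐ[ν] 0 :=
  ae_eq_zero_of_integral_mul_cexp_eq_zero hh (integral_mul_cexp_eq_zero hh hR
    (integral_mul_inner_pow_eq_zero hh hR hσ hC hne h0))

end Discriminatory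

/-! ### Ridge averages and smooth approximation -/

section RidgeIntegral

variable {E : Type*} [NormedAddCommGroup E] [InnerProductSpace ℝ E]
  {Z : Type*} [MeasurableSpace Z] {m : Measure Z} {p β : Z → ℝ} {W : Z → E} {τ : ℝ → ℝ}

/-- An average of ridge functions `y ↦ p(z) τ(⟪W(z), y⟫ + β(z))` is continuously differentiable,
by differentiation under the integral sign. -/
theorem contDiff_integral_ridge (hp : Integrable p m) (hW : AEStronglyMeasurable W m)
    (hβ : AEStronglyMeasurable β m) (hpW : Integrable (fun z => ‖p z‖ * ‖W z‖) m)
    (hτ : ContDiff ℝ 1 τ) {C₀ C₁ : ℝ} (hC₀ : ∀ x, |τ x| ≤ C₀) (hC₁ : ∀ x, |deriv τ x| ≤ C₁) :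
    ContDiff ℝ 1 fun y : E => ∫ z, p z * τ (⟪W z, y⟫ + β z) ∂m := by
  have harg : ∀ y : E, AEStronglyMeasurable (fun z => ⟪W z, y⟫ + β z) m := fun y =>
    (hW.inner aestronglyMeasurable_const).add hβ
  have hτ' : Continuous (deriv τ) := hτ.continuous_deriv le_rfl
  have hsl : AEStronglyMeasurable (fun z => innerSL ℝ (W z)) m :=
    (innerSL ℝ).continuous.comp_aestronglyMeasurable hW
  let F' : E → Z → (E →L[ℝ] ℝ) := fun y z => (p z * deriv τ (⟪W z, y⟫ + β z)) • innerSL ℝ (W z)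
  have hF'm : ∀ y, AEStronglyMeasurable (F' y) m := fun y =>
    (hp.aestronglyMeasurable.mul (hτ'.comp_aestronglyMeasurable (harg y))).smul hsl
  have hF'b : ∀ y z, ‖F' y z‖ ≤ ‖p z‖ * ‖W z‖ * C₁ := by
    intro y z
    simp only [F', norm_smul, norm_mul, innerSL_apply_norm]
    rw [mul_right_comm]
    gcongr
    exact hC₁ _
  have hd : ∀ y : E, HasFDerivAt (fun y : E => ∫ z, p z * τ (⟪W z, y⟫ + β z) ∂m)
      (∫ z, F' y z ∂m) y := by
    intro y
    refine hasFDerivAt_integral_of_dominated_of_fderiv_le (s := univ)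
      (bound := fun z => ‖p z‖ * ‖W z‖ * C₁) univ_mem (.of_forall fun y =>
      hp.aestronglyMeasurable.mul (hτ.continuous.comp_aestronglyMeasurable (harg y)))
      (hp.mul_bdd (c := C₀) (hτ.continuous.comp_aestronglyMeasurable (harg y))
        (.of_forall fun z => hC₀ _)) (hF'm y) (.of_forall fun z y _ => hF'b y z)
      (hpW.mul_const C₁) (.of_forall fun z y _ => ?_)
    have h1 : HasFDerivAt (fun y : E => ⟪W z, y⟫ + β z) (innerSL ℝ (W z)) y :=
      (innerSL ℝ (W z)).hasFDerivAt.add_const _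
    have h2 := ((hτ.differentiable one_ne_zero _).hasDerivAt.comp_hasFDerivAt y h1).const_mul (p z)
    exact h2.congr_fderiv (smul_smul _ _ _)
  refine contDiff_one_iff_fderiv.2 ⟨fun y => (hd y).differentiableAt, ?_⟩
  rw [funext fun y => (hd y).fderiv]
  refine continuous_of_dominated hF'm (fun y => .of_forall fun z => hF'b y z)
    (hpW.mul_const C₁) (.of_forall fun z => ?_)
  exact (continuous_const.mul (hτ'.comp (by fun_prop))).smul continuous_const

end RidgeIntegral

section Smoothing

variable {E : Type*} [NormedAddCommGroup E] [InnerProductSpace ℝ E] [FiniteDimensional ℝ E]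

/-- Smooth functions are dense in `C¹` for uniform convergence on compact sets of the function and
its derivative. -/
theorem exists_contDiff_approx {ψ : E → ℝ} (hψ : ContDiff ℝ 1 ψ) {K : Set E} (hK : IsCompact K)
    {ε : ℝ} (hε : 0 < ε) : ∃ φ : E → ℝ, ContDiff ℝ ∞ φ ∧
      ∀ x ∈ K, |φ x - ψ x| ≤ ε ∧ ‖fderiv ℝ φ x - fderiv ℝ ψ x‖ ≤ ε := by
  let _ : MeasurableSpace E := borel E
  have : BorelSpace E := ⟨rfl⟩
  obtain ⟨r, hr⟩ := hK.isBounded.subset_ball (0 : E)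
  let χ : ContDiffBump (0 : E) := ⟨max r 1, max r 1 + 1, by positivity, by linarith⟩
  -- The cut-off `χ ψ` agrees with `ψ` near `K`; compact support makes it and its derivative
  -- uniformly continuous, so that mollification approximates both uniformly.
  let g : E → ℝ := fun x => χ x * ψ x
  have hg : ContDiff ℝ 1 g := χ.contDiff.mul hψ
  have hgc : HasCompactSupport g := χ.hasCompactSupport.mul_right
  have hgK : ∀ x ∈ K, g =ᶠ[𝓝 x] ψ := by
    intro x hx
    have h1 : x ∈ Metric.ball (0 : E) (max r 1) :=
      Metric.ball_subset_ball (le_max_left _ _) (hr hx)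
    filter_upwards [χ.eventuallyEq_one_of_mem_ball h1] with y hy
    simp only [g, hy, Pi.one_apply, one_mul]
  have hg' : Continuous (fderiv ℝ g) := hg.continuous_fderiv one_ne_zero
  have hg'c : HasCompactSupport (fderiv ℝ g) := hgc.fderiv ℝ
  obtain ⟨δ₁, hδ₁, h₁⟩ := Metric.uniformContinuous_iff.1
    (hgc.uniformContinuous_of_continuous hg.continuous) ε hε
  obtain ⟨δ₂, hδ₂, h₂⟩ := Metric.uniformContinuous_iff.1
    (hg'c.uniformContinuous_of_continuous hg') ε hε
  have hδ : 0 < min δ₁ δ₂ := lt_min hδ₁ hδ₂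
  let ρ : ContDiffBump (0 : E) := ⟨min δ₁ δ₂ / 2, min δ₁ δ₂, half_pos hδ, half_lt_self hδ⟩
  let φ := convolution (ρ.normed volume) g (ContinuousLinearMap.lsmul ℝ ℝ) volume
  have hφ' : ∀ x, fderiv ℝ φ x = convolution (ρ.normed volume) (fderiv ℝ g)
      (ContinuousLinearMap.lsmul ℝ ℝ) volume x := by
    intro x
    rw [(hgc.hasFDerivAt_convolution_right (ContinuousLinearMap.lsmul ℝ ℝ)
      ρ.continuous_normed.locallyIntegrable hg x).fderiv]
    refine integral_congr_ae (.of_forall fun t => ?_)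
    ext v
    rfl
  refine ⟨φ, ρ.hasCompactSupport_normed.contDiff_convolution_left _ ρ.contDiff_normed
    hg.continuous.locallyIntegrable, fun x hx => ⟨?_, ?_⟩⟩
  · rw [← (hgK x hx).eq_of_nhds, ← Real.dist_eq]
    exact ContDiffBump.dist_normed_convolution_le hg.continuous.aestronglyMeasurable
      fun y hy => (h₁ (lt_of_lt_of_le hy (min_le_left _ _))).le
  · rw [← (hgK x hx).fderiv_eq, hφ', ← dist_eq_norm]
    exact ContDiffBump.dist_normed_convolution_le hg'.aestronglyMeasurable
      fun y hy => (h₂ (lt_of_lt_of_le hy (min_le_right _ _))).le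

end Smoothing

/-! ### Surface measure and sampling measure -/

variable {n : ℕ}

/-- The boundary of a bounded open set with `C^{k,a}` boundary, `k ≥ 1`, has finite surface
measure: locally it lies in the image of a ball of dimension `n - 1` under a Lipschitz map. -/
theorem HasHolderBoundary.hausdorffMeasure_frontier_lt_top {Ω : Set (Space n)}
    (hΩ : IsOpen Ω) (hb : Bornology.IsBounded Ω) {k : ℕ} (hk : 1 ≤ k) {a : ℝ≥0}
    (h : HasHolderBoundary Ω k a) : μH[(n : ℝ) - 1] (frontier Ω) < ⊤ := by
  have hcomp : IsCompact (frontier Ω) :=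
    Metric.isCompact_of_isClosed_isBounded isClosed_frontier
      (hb.closure.subset frontier_subset_closure)
  refine hcomp.measure_lt_top_of_nhdsWithin fun x₀ hx₀ => ?_
  obtain ⟨r, hr, ν, hν, γ, hγ, -, hΩr⟩ := h x₀ hx₀
  let π := (ℝ ∙ ν)ᗮ.orthogonalProjectionOnto
  let Γ : (ℝ ∙ ν)ᗮ → Space n := fun z => (z : Space n) + γ z • ν
  have hΓ : ContDiff ℝ 1 Γ :=
    ((ℝ ∙ ν)ᗮ.subtypeL.contDiff).add ((hγ.of_le (by exact_mod_cast hk)).smul contDiff_const)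
  obtain ⟨K, t, ht, hK⟩ := (hΓ.contDiffAt (x := π x₀)).exists_lipschitzOnWith
  obtain ⟨δ, hδ, hδt⟩ := Metric.nhds_basis_closedBall.mem_iff.1 ht
  have hrank : (n : ℝ) - 1 = Module.finrank ℝ (ℝ ∙ ν)ᗮ := by
    have h1 := (ℝ ∙ ν).finrank_add_finrank_orthogonal
    have h2 : ν ≠ 0 := fun h0 => by simp [h0] at hν
    rw [finrank_span_singleton h2, finrank_euclideanSpace_fin] at h1
    have h3 : (1 : ℝ) + Module.finrank ℝ (ℝ ∙ ν)ᗮ = n := by exact_mod_cast h1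
    linarith
  have hn' : (0 : ℝ) ≤ (n : ℝ) - 1 := by
    rw [hrank]
    positivity
  refine ⟨Γ '' Metric.closedBall (π x₀) δ, ?_, ?_⟩
  · -- Near `x₀` a boundary point lies on the graph of `γ`: it is a limit of points of `Ω`, which
    -- gives one inequality, and it is not in `Ω`, which gives the other.
    have hU : Metric.ball x₀ r ∩ π ⁻¹' Metric.closedBall (π x₀) δ ∈ 𝓝 x₀ :=
      inter_mem (Metric.ball_mem_nhds x₀ hr)
        (π.continuous.continuousAt.preimage_mem_nhds (Metric.closedBall_mem_nhds _ hδ))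
    filter_upwards [mem_nhdsWithin_of_mem_nhds hU, self_mem_nhdsWithin] with x hx hxf
    have hball : Metric.ball x₀ r ∈ 𝓝 x := Metric.isOpen_ball.mem_nhds hx.1
    have hle : γ (π x) ≤ ⟪ν, x⟫ := by
      have h1 : x ∈ closure (Ω ∩ Metric.ball x₀ r) := by
        rw [mem_closure_iff_nhds]
        intro s hs
        obtain ⟨y, hy⟩ := mem_closure_iff_nhds.1 (frontier_subset_closure hxf) _
          (inter_mem hs hball)
        exact ⟨y, hy.1.1, hy.2, hy.1.2⟩
      have h2 : IsClosed {x : Space n | γ (π x) ≤ ⟪ν, x⟫} :=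
        isClosed_le (hγ.continuous.comp π.continuous) (by fun_prop)
      refine closure_minimal (fun y hy => ?_) h2 h1
      rw [hΩr] at hy
      exact hy.2.le
    have hge : ⟪ν, x⟫ ≤ γ (π x) := by
      by_contra! h1
      have h2 : x ∈ Ω ∩ Metric.ball x₀ r := by
        rw [hΩr]
        exact ⟨hx.1, h1⟩
      rw [hΩ.frontier_eq] at hxf
      exact hxf.2 h2.1
    refine ⟨π x, hx.2, ?_⟩
    have h3 := (ℝ ∙ ν).starProjection_add_starProjection_orthogonal x
    rw [Submodule.starProjection_unit_singleton ℝ hν] at h3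
    simp only [Γ, le_antisymm hle hge]
    rw [add_comm]
    exact h3
  · refine ((hK.mono hδt).hausdorffMeasure_image_le hn').trans_lt
      (ENNReal.mul_lt_top (ENNReal.rpow_lt_top_of_nonneg hn' (by simp)) ?_)
    rw [hrank]
    have := isAddHaarMeasure_hausdorffMeasure (E := (ℝ ∙ ν)ᗮ)
    exact (isCompact_closedBall _ _).measure_lt_top

namespace SampledDomain

variable (D : SampledDomain n)

theorem μ_absolutelyContinuous : D.μ ≪ volume.restrict D.carrier :=
  withDensity_absolutelyContinuous _ _

theorem ae_mem_carrier : ∀ᵐ x ∂D.μ, x ∈ D.carrier :=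
  D.μ_absolutelyContinuous.ae_le (ae_restrict_mem D.isOpen.measurableSet)

theorem ae_iff_ae_volume {p : Space n → Prop} :
    (∀ᵐ x ∂D.μ, p x) ↔ ∀ᵐ x ∂volume.restrict D.carrier, p x :=
  ⟨D.ae_volume_of_ae, fun h => D.μ_absolutelyContinuous.ae_le h⟩

instance : IsFiniteMeasure D.μ := by
  obtain ⟨m, M, hm, hb⟩ := D.exists_bounds
  refine isFiniteMeasure_withDensity (ne_top_of_le_ne_top (b := ∫⁻ _ in D.carrier,
    ENNReal.ofReal M) ?_ (setLIntegral_mono' D.isOpen.measurableSet fun x hx =>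
      ENNReal.ofReal_le_ofReal (hb x hx).2))
  rw [setLIntegral_const]
  exact ENNReal.mul_ne_top ENNReal.ofReal_ne_top D.isBounded.measure_lt_top.ne

theorem exists_ae_norm_le : ∃ R : ℝ, 0 ≤ R ∧ ∀ᵐ x ∂D.μ, ‖x‖ ≤ R := by
  obtain ⟨R, hR⟩ := D.isBounded.exists_norm_le
  refine ⟨max R 0, le_max_right _ _, ?_⟩
  filter_upwards [D.ae_mem_carrier] with x hx
  exact (hR x hx).trans (le_max_left _ _)

theorem exists_abs_le_of_continuous {f : Space n → ℝ} (hf : Continuous f) :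
    ∃ C : ℝ, 0 ≤ C ∧ ∀ᵐ x ∂D.μ, |f x| ≤ C := by
  obtain ⟨C, hC⟩ := D.isBounded.isCompact_closure.exists_bound_of_continuousOn hf.continuousOn
  refine ⟨max C 0, le_max_right _ _, ?_⟩
  filter_upwards [D.ae_mem_carrier] with x hx
  exact (hC x (subset_closure hx)).trans (le_max_left _ _)

theorem memLp_of_continuous {f : Space n → ℝ} (hf : Continuous f) (p : ℝ≥0∞) :
    MemLp f p D.μ := by
  obtain ⟨C, -, hC⟩ := D.exists_abs_le_of_continuous hf
  exact MemLp.of_bound hf.aestronglyMeasurable C hC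

/-- Convergence in `L²(μ)` implies convergence of the pairings with test functions. -/
theorem tendsto_setIntegral_mul {f : ℕ → Space n → ℝ} {g θ : Space n → ℝ}
    (hf : ∀ j, MemLp (f j) 2 D.μ) (hg : MemLp g 2 D.μ) (hθ : Continuous θ)
    (hθ' : HasCompactSupport θ)
    (h : Tendsto (fun j => eLpNorm (fun x => f j x - g x) 2 D.μ) atTop (𝓝 0)) :
    Tendsto (fun j => ∫ x in D.carrier, f j x * θ x) atTop
      (𝓝 (∫ x in D.carrier, g x * θ x)) := by
  obtain ⟨c, hc, hle⟩ := D.smul_volume_le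
  have hf' := fun j => (hf j).of_measure_le_smul hc hle
  have hg' := hg.of_measure_le_smul hc hle
  have hθ2 : MemLp θ 2 (volume.restrict D.carrier) :=
    (hθ.memLp_of_hasCompactSupport hθ').restrict _
  refine tendsto_integral_of_L1' _ (hg'.aestronglyMeasurable.mul hθ2.aestronglyMeasurable)
    (.of_forall fun j => (hf' j).integrable_mul hθ2) ?_
  have hlim : Tendsto (fun j => c ^ (1 / (2 : ℝ≥0∞).toReal) *
      eLpNorm (fun x => f j x - g x) 2 D.μ * eLpNorm θ 2 (volume.restrict D.carrier))
      atTop (𝓝 0) := by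
    have h1 := ENNReal.Tendsto.const_mul (a := c ^ (1 / (2 : ℝ≥0∞).toReal)) h
      (Or.inr (ENNReal.rpow_ne_top_of_nonneg (by positivity) hc))
    have h2 := ENNReal.Tendsto.mul_const (b := eLpNorm θ 2 (volume.restrict D.carrier)) h1
      (Or.inr hθ2.eLpNorm_ne_top)
    simpa using h2
  refine tendsto_of_tendsto_of_tendsto_of_le_of_le tendsto_const_nhds hlim
    (fun _ => zero_le) fun j => ?_
  have h3 : (fun x => f j x * θ x) - g * θ = (fun x => f j x - g x) • θ := by
    ext x
    simp [sub_mul]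
  rw [h3]
  refine (eLpNorm_smul_le_mul_eLpNorm (p := 2) (q := 2) hθ2.aestronglyMeasurable
    ((hf' j).sub hg').aestronglyMeasurable).trans ?_
  gcongr
  refine (eLpNorm_mono_measure _ hle).trans ?_
  rw [eLpNorm_smul_measure_of_ne_top (by simp), smul_eq_mul, one_div, one_div,
    ENNReal.toReal_inv]
  rfl

end SampledDomain

/-! ### Boundary traces -/

/-- The index of `∂_i`, as an index of order at most one. -/
def DerivIndex.first₁ (i : Fin n) : DerivIndex n 1 := ⟨⟨1, by norm_num⟩, fun _ => i⟩

theorem DerivIndex.eq_zero_or_eq_first₁ (a : DerivIndex n 1) :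
    a = .zero n 1 ∨ ∃ i, a = .first₁ i := by
  obtain ⟨⟨m, hm⟩, I⟩ := a
  interval_cases m
  · exact Or.inl (congrArg (Sigma.mk _) (funext fun i => i.elim0))
  · exact Or.inr ⟨I ⟨0, by norm_num⟩, congrArg (Sigma.mk _)
      (funext fun i => congrArg I (Subsingleton.elim (α := Fin 1) _ _))⟩

theorem partialDeriv_zero (k : ℕ) (φ : Space n → ℝ) (x : Space n) :
    partialDeriv (DerivIndex.zero n k).2 φ x = φ x :=
  iteratedFDeriv_zero_apply _

theorem partialDeriv_first₁ (i : Fin n) (φ : Space n → ℝ) (x : Space n) :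
    partialDeriv (DerivIndex.first₁ i).2 φ x = fderiv ℝ φ x (EuclideanSpace.single i 1) :=
  iteratedFDeriv_one_apply _

theorem abs_apply_single_le (T : Space n →L[ℝ] ℝ) (i : Fin n) :
    |T (EuclideanSpace.single i 1)| ≤ ‖T‖ := by
  simpa using T.le_opNorm (EuclideanSpace.single i (1 : ℝ))

theorem continuous_fderiv_apply {ψ : Space n → ℝ} (hψ : ContDiff ℝ 1 ψ) (v : Space n) :
    Continuous fun x => fderiv ℝ ψ x v :=
  (hψ.continuous_fderiv one_ne_zero).clm_apply continuous_const

section eLpNorm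

variable {X : Type*} [MeasurableSpace X] {m : Measure X}

theorem tendsto_eLpNorm_sub_of_tendsto {f f' : ℕ → X → ℝ} {g : X → ℝ}
    (hf : ∀ j, AEStronglyMeasurable (f j) m) (hf' : ∀ j, AEStronglyMeasurable (f' j) m)
    (hg : AEStronglyMeasurable g m)
    (h : Tendsto (fun j => eLpNorm (fun x => f j x - f' j x) 2 m) atTop (𝓝 0))
    (h' : Tendsto (fun j => eLpNorm (fun x => f' j x - g x) 2 m) atTop (𝓝 0)) :
    Tendsto (fun j => eLpNorm (fun x => f j x - g x) 2 m) atTop (𝓝 0) := by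
  refine tendsto_of_tendsto_of_tendsto_of_le_of_le tendsto_const_nhds
    (by simpa using h.add h') (fun _ => zero_le) fun j => ?_
  refine le_trans (le_of_eq ?_)
    (eLpNorm_add_le ((hf j).sub (hf' j)) ((hf' j).sub hg) one_le_two)
  congr 1
  ext x
  simp

theorem tendsto_eLpNorm_of_abs_le [IsFiniteMeasure m] {f : ℕ → X → ℝ}
    (h : ∀ j : ℕ, ∀ᵐ x ∂m, |f j x| ≤ 1 / ((j : ℝ) + 1)) :
    Tendsto (fun j => eLpNorm (f j) 2 m) atTop (𝓝 0) := by
  have h1 : Tendsto (fun j : ℕ => m univ ^ (2 : ℝ≥0∞).toReal⁻¹ *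
      ENNReal.ofReal (1 / ((j : ℝ) + 1))) atTop (𝓝 0) := by
    have h2 := ENNReal.tendsto_ofReal (tendsto_one_div_add_atTop_nhds_zero_nat (𝕜 := ℝ))
    rw [ENNReal.ofReal_zero] at h2
    simpa using ENNReal.Tendsto.const_mul (a := m univ ^ (2 : ℝ≥0∞).toReal⁻¹) h2
      (Or.inr (ENNReal.rpow_ne_top_of_nonneg (by positivity) (measure_ne_top _ _)))
  exact tendsto_of_tendsto_of_tendsto_of_le_of_le tendsto_const_nhds h1
    (fun _ => zero_le) fun j => eLpNorm_le_of_ae_bound (h j)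

theorem tendsto_eLpNorm_mul {f : ℕ → X → ℝ} {θ : X → ℝ} {C : ℝ}
    (hθ : ∀ᵐ x ∂m, |θ x| ≤ C) (h : Tendsto (fun j => eLpNorm (f j) 2 m) atTop (𝓝 0)) :
    Tendsto (fun j => eLpNorm (fun x => θ x * f j x) 2 m) atTop (𝓝 0) := by
  refine tendsto_of_tendsto_of_tendsto_of_le_of_le tendsto_const_nhds
    (g := fun _ => 0) (h := fun j => ENNReal.ofReal C * eLpNorm (f j) 2 m) ?_
    (fun _ => zero_le) fun j => ?_
  · simpa using ENNReal.Tendsto.const_mul (a := ENNReal.ofReal C) h (Or.inr ENNReal.ofReal_ne_top)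
  · refine eLpNorm_le_mul_eLpNorm_of_ae_le_mul ?_ 2
    filter_upwards [hθ] with x hx
    rw [norm_mul]
    exact mul_le_mul_of_nonneg_right hx (norm_nonneg _)

theorem tendsto_eLpNorm_add {f g : ℕ → X → ℝ} (hf : ∀ j, AEStronglyMeasurable (f j) m)
    (hg : ∀ j, AEStronglyMeasurable (g j) m)
    (h : Tendsto (fun j => eLpNorm (f j) 2 m) atTop (𝓝 0))
    (h' : Tendsto (fun j => eLpNorm (g j) 2 m) atTop (𝓝 0)) :
    Tendsto (fun j => eLpNorm (fun x => f j x + g j x) 2 m) atTop (𝓝 0) :=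
  tendsto_of_tendsto_of_tendsto_of_le_of_le tendsto_const_nhds
    (by simpa using h.add h') (fun _ => zero_le) fun j => eLpNorm_add_le (hf j) (hg j) one_le_two

end eLpNorm

/-- A curve whose velocity lies in a closed subspace stays in a coset of the subspace, because it
is constant modulo the subspace. -/
theorem sub_mem_of_hasDerivWithinAt_mem {V : Type*} [NormedAddCommGroup V] [NormedSpace ℝ V]
    (S : Submodule ℝ V) (hS : IsClosed (S : Set V)) {q q' : ℝ → V}
    (hq : ∀ t, 0 ≤ t → HasDerivWithinAt q (q' t) (Ici 0) t) (hq' : ∀ t, 0 ≤ t → q' t ∈ S)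
    {t : ℝ} (ht : 0 ≤ t) : q t - q 0 ∈ S := by
  have : IsClosed (S : Set V) := hS
  have hd : ∀ s, 0 ≤ s → HasDerivWithinAt (fun s => S.mkQL (q s)) 0 (Ici 0) s := by
    intro s hs
    have h1 := S.mkQL.hasFDerivAt.comp_hasDerivWithinAt s (hq s hs)
    exact h1.congr_deriv ((Submodule.Quotient.mk_eq_zero _).2 (hq' s hs))
  have hc := constant_of_has_deriv_right_zero (f := fun s => S.mkQL (q s)) (a := 0) (b := t)
    (fun s hs => ((hd s hs.1).continuousWithinAt).mono Icc_subset_Ici_self)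
    (fun s hs => (hd s hs.1).mono (Ici_subset_Ici.2 hs.1)) t ⟨ht, le_rfl⟩
  exact (Submodule.Quotient.eq _).1 hc

namespace SampledDomain

variable {D : SampledDomain n}

theorem aestronglyMeasurable_weakDeriv {k : ℕ} (u : D.sobolev k) (a : DerivIndex n k) :
    AEStronglyMeasurable (weakDeriv u a) D.μ :=
  Lp.aestronglyMeasurable _

/-- Integration by parts against a test function supported in the domain. -/
theorem setIntegral_mul_fderiv_eq {ψ φ : Space n → ℝ} (hψ : ContDiff ℝ 1 ψ)
    (hφ : ContDiff ℝ ∞ φ) (hφ' : HasCompactSupport φ) (hs : tsupport φ ⊆ D.carrier)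
    (v : Space n) :
    ∫ x in D.carrier, ψ x * fderiv ℝ φ x v = -∫ x in D.carrier, fderiv ℝ ψ x v * φ x := by
  have hφ1 : ContDiff ℝ 1 φ := hφ.of_le (by exact_mod_cast le_top)
  have hφv : HasCompactSupport fun x => fderiv ℝ φ x v := hφ'.fderiv_apply ℝ v
  have h0 : ∀ x ∉ D.carrier, φ x = 0 := fun x hx => image_eq_zero_of_notMem_tsupport
    fun h => hx (hs h)
  have h0' : ∀ x ∉ D.carrier, fderiv ℝ φ x v = 0 := fun x hx => by
    rw [fderiv_of_notMem_tsupport (𝕜 := ℝ) fun h => hx (hs h)]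
    rfl
  rw [setIntegral_eq_integral_of_forall_compl_eq_zero fun x hx => by rw [h0' x hx, mul_zero],
    setIntegral_eq_integral_of_forall_compl_eq_zero fun x hx => by rw [h0 x hx, mul_zero]]
  exact integral_mul_fderiv_eq_neg_fderiv_mul_of_integrable
    (((continuous_fderiv_apply hψ v).mul hφ.continuous).integrable_of_hasCompactSupport
      hφ'.mul_left)
    ((hψ.continuous.mul (continuous_fderiv_apply hφ1 v)).integrable_of_hasCompactSupport
      hφv.mul_left)
    ((hψ.continuous.mul hφ.continuous).integrable_of_hasCompactSupport hφ'.mul_left)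
    (fun x _ => hψ.differentiable one_ne_zero x) (fun x _ => hφ1.differentiable one_ne_zero x)

/-- The `L²`-limit of the classical derivatives of `C¹` functions that converge to `u` in `L²` is
the weak derivative of `u`. -/
theorem weakDeriv_ae_eq_of_tendsto {u : D.sobolev 1} {ψ : ℕ → Space n → ℝ}
    (hψ : ∀ j, ContDiff ℝ 1 (ψ j)) {i : Fin n} {w : Space n → ℝ} (hw : MemLp w 2 D.μ)
    (h0 : Tendsto (fun j => eLpNorm (fun x => ψ j x - toL2 u x) 2 D.μ) atTop (𝓝 0))
    (h1 : Tendsto (fun j => eLpNorm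
      (fun x => fderiv ℝ (ψ j) x (EuclideanSpace.single i 1) - w x) 2 D.μ) atTop (𝓝 0)) :
    weakDeriv u (.first₁ i) =ᵐ[D.μ] w := by
  obtain ⟨c, hc, hle⟩ := D.smul_volume_le
  have hw' := hw.of_measure_le_smul hc hle
  have hd' := D.memLp_volume (weakDeriv u (.first₁ i))
  have : IsFiniteMeasure (volume.restrict D.carrier) :=
    ⟨by simpa using D.isBounded.measure_lt_top⟩
  have key := D.isOpen.ae_eq_zero_of_integral_contDiff_smul_eq_zero
    (μ := volume.restrict D.carrier) (f := fun x => weakDeriv u (.first₁ i) x - w x)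
    (((hd'.sub hw').integrable one_le_two).locallyIntegrable.locallyIntegrableOn _) ?_
  · rw [Filter.EventuallyEq, D.ae_iff_ae_volume]
    filter_upwards [key, ae_restrict_mem D.isOpen.measurableSet] with x hx hxD
    exact sub_eq_zero.1 (hx hxD)
  · intro φ hφ hφ' hs
    have hφ1 : ContDiff ℝ 1 φ := hφ.of_le (by exact_mod_cast le_top)
    let v : Space n := EuclideanSpace.single i 1
    have hA := D.tendsto_setIntegral_mul (fun j => D.memLp_of_continuous (hψ j).continuous 2)
      (Lp.memLp (toL2 u)) (continuous_fderiv_apply hφ1 v) (hφ'.fderiv_apply ℝ v) h0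
    have hB := D.tendsto_setIntegral_mul
      (fun j => D.memLp_of_continuous (continuous_fderiv_apply (hψ j) v) 2) hw
      hφ.continuous hφ' h1
    simp_rw [setIntegral_mul_fderiv_eq (hψ _) hφ hφ' hs v] at hA
    have h2 := tendsto_nhds_unique hA hB.neg
    have h3 := u.2 (.first₁ i) φ hφ hφ' hs
    simp only [partialDeriv_first₁] at h3
    change ∫ x in D.carrier, toL2 u x * fderiv ℝ φ x v =
      (-1) ^ 1 * ∫ x in D.carrier, weakDeriv u (.first₁ i) x * φ x at h3
    rw [h2, pow_one, neg_one_mul, neg_inj] at h3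
    have hi1 := D.integrable_mul (weakDeriv u (.first₁ i)) hφ.continuous hφ'
    have hi2 : Integrable (fun x => w x * φ x) (volume.restrict D.carrier) :=
      MemLp.integrable_mul (p := 2) (q := 2) hw'
        ((hφ.continuous.memLp_of_hasCompactSupport hφ').restrict _)
    calc ∫ x in D.carrier, φ x • (weakDeriv u (.first₁ i) x - w x)
        = ∫ x in D.carrier, (weakDeriv u (.first₁ i) x * φ x - w x * φ x) := by
          congr 1 with x
          rw [smul_eq_mul]
          ring
      _ = 0 := by rw [integral_sub hi1 hi2, h3, sub_self]

/-- The trace may be computed with approximations that are only continuously differentiable. -/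
theorem hasTrace_of_contDiff_one_approx [IsFiniteMeasure D.surface] {u : D.sobolev 1}
    {g : Space n → ℝ} (hg : MemLp g 2 D.surface) {ψ : ℕ → Space n → ℝ}
    (hψ : ∀ j, ContDiff ℝ 1 (ψ j)) {w : Fin n → Space n → ℝ} (hw : ∀ i, MemLp (w i) 2 D.μ)
    (h0 : Tendsto (fun j => eLpNorm (fun x => ψ j x - toL2 u x) 2 D.μ) atTop (𝓝 0))
    (h1 : ∀ i, Tendsto (fun j => eLpNorm
      (fun x => fderiv ℝ (ψ j) x (EuclideanSpace.single i 1) - w i x) 2 D.μ) atTop (𝓝 0))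
    (hs : Tendsto (fun j => eLpNorm (fun x => ψ j x - g x) 2 D.surface) atTop (𝓝 0)) :
    HasTrace u g := by
  choose φ hφ hφψ using fun j : ℕ => exists_contDiff_approx (hψ j) D.isBounded.isCompact_closure
    (ε := 1 / ((j : ℝ) + 1)) (by positivity)
  have hφ1 : ∀ j, ContDiff ℝ 1 (φ j) := fun j => (hφ j).of_le (by exact_mod_cast le_top)
  have hmem : ∀ᵐ x ∂D.μ, x ∈ closure D.carrier :=
    D.ae_mem_carrier.mono fun x hx => subset_closure hx
  have hmem' : ∀ᵐ x ∂D.surface, x ∈ closure D.carrier :=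
    (ae_restrict_mem isClosed_frontier.measurableSet).mono fun x hx => frontier_subset_closure hx
  refine ⟨hg, φ, hφ, fun a => ?_, ?_⟩
  · rcases a.eq_zero_or_eq_first₁ with rfl | ⟨i, rfl⟩
    · simp only [partialDeriv_zero]
      refine tendsto_eLpNorm_sub_of_tendsto (f' := ψ)
        (fun j => (hφ j).continuous.aestronglyMeasurable)
        (fun j => (hψ j).continuous.aestronglyMeasurable) (aestronglyMeasurable_weakDeriv _ _)
        (tendsto_eLpNorm_of_abs_le fun j => ?_) h0
      filter_upwards [hmem] with x hx using (hφψ j x hx).1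
    · simp only [partialDeriv_first₁]
      have hwi := weakDeriv_ae_eq_of_tendsto hψ (hw i) h0 (h1 i)
      refine tendsto_eLpNorm_sub_of_tendsto
        (f' := fun j x => fderiv ℝ (ψ j) x (EuclideanSpace.single i 1))
        (fun j => (continuous_fderiv_apply (hφ1 j) _).aestronglyMeasurable)
        (fun j => (continuous_fderiv_apply (hψ j) _).aestronglyMeasurable)
        (aestronglyMeasurable_weakDeriv _ _) (tendsto_eLpNorm_of_abs_le fun j => ?_)
        ((h1 i).congr fun j => eLpNorm_congr_ae ?_)
      · filter_upwards [hmem] with x hx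
        rw [← _root_.sub_apply]
        exact (abs_apply_single_le _ i).trans (hφψ j x hx).2
      · filter_upwards [hwi] with x hx
        rw [hx]
  · refine tendsto_eLpNorm_sub_of_tendsto (f' := ψ)
      (fun j => (hφ j).continuous.aestronglyMeasurable)
      (fun j => (hψ j).continuous.aestronglyMeasurable) hg.aestronglyMeasurable
      (tendsto_eLpNorm_of_abs_le fun j => ?_) hs
    filter_upwards [hmem'] with x hx using (hφψ j x hx).1

/-- The trace of a Sobolev function that is `C¹` up to the boundary is its restriction. -/
theorem hasTrace_of_contDiff_one [IsFiniteMeasure D.surface] {u : D.sobolev 1}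
    {g G : Space n → ℝ} (hG : ContDiff ℝ 1 G) (hu : ∀ᵐ y ∂D.μ, toL2 u y = G y)
    (hgG : ∀ x ∈ frontier D.carrier, G x = g x) (hg : MemLp g 2 D.surface) :
    HasTrace u g := by
  refine hasTrace_of_contDiff_one_approx hg (ψ := fun _ => G) (fun _ => hG)
    (w := fun i x => fderiv ℝ G x (EuclideanSpace.single i 1))
    (fun i => D.memLp_of_continuous (continuous_fderiv_apply hG _) 2) ?_ (fun i => by simp) ?_
  · refine tendsto_const_nhds.congr fun j => Eq.symm ?_
    refine (eLpNorm_congr_ae (g := 0) ?_).trans eLpNorm_zero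
    filter_upwards [hu] with x hx
    simp [hx]
  · refine tendsto_const_nhds.congr fun j => Eq.symm ?_
    refine (eLpNorm_congr_ae (g := 0) ?_).trans eLpNorm_zero
    filter_upwards [ae_restrict_mem isClosed_frontier.measurableSet] with x hx
    simp [hgG x hx]

/-- Multiplication by a `C¹` function that is `1` on the boundary does not change the trace. -/
theorem HasTrace.mul_of_eq_one [IsFiniteMeasure D.surface] {f u : D.sobolev 1}
    {g θ : Space n → ℝ} (hf : HasTrace f g) (hθ : ContDiff ℝ 1 θ)
    (hθ1 : ∀ x ∈ frontier D.carrier, θ x = 1)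
    (hu : ∀ᵐ y ∂D.μ, toL2 u y = θ y * toL2 f y) : HasTrace u g := by
  obtain ⟨hg, φ, hφ, h1, hs⟩ := hf
  have hφ1 : ∀ j, ContDiff ℝ 1 (φ j) := fun j => (hφ j).of_le (by exact_mod_cast le_top)
  have h0 := h1 (.zero n 1)
  simp only [partialDeriv_zero] at h0
  obtain ⟨C, -, hC⟩ := D.exists_abs_le_of_continuous hθ.continuous
  refine hasTrace_of_contDiff_one_approx hg (ψ := fun j x => θ x * φ j x)
    (fun j => hθ.mul (hφ1 j))
    (w := fun i x => θ x * weakDeriv f (.first₁ i) x +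
      fderiv ℝ θ x (EuclideanSpace.single i 1) * toL2 f x) (fun i => ?_) ?_ (fun i => ?_) ?_
  · obtain ⟨C', -, hC'⟩ := D.exists_abs_le_of_continuous
      (continuous_fderiv_apply hθ (EuclideanSpace.single i 1))
    refine MemLp.add ?_ ?_
    · refine (Lp.memLp (weakDeriv f (.first₁ i))).of_le_mul (c := C)
        (hθ.continuous.aestronglyMeasurable.mul (aestronglyMeasurable_weakDeriv _ _)) ?_
      filter_upwards [hC] with x hx
      rw [norm_mul]
      exact mul_le_mul_of_nonneg_right hx (norm_nonneg _)
    · refine (Lp.memLp (toL2 f)).of_le_mul (c := C')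
        ((continuous_fderiv_apply hθ _).aestronglyMeasurable.mul
          (aestronglyMeasurable_weakDeriv _ _)) ?_
      filter_upwards [hC'] with x hx
      rw [norm_mul]
      exact mul_le_mul_of_nonneg_right hx (norm_nonneg _)
  · refine (tendsto_eLpNorm_mul hC h0).congr fun j => eLpNorm_congr_ae ?_
    filter_upwards [hu] with x hx
    rw [hx, mul_sub]
    rfl
  · obtain ⟨C', -, hC'⟩ := D.exists_abs_le_of_continuous
      (continuous_fderiv_apply hθ (EuclideanSpace.single i 1))
    have h1i := h1 (.first₁ i)
    simp only [partialDeriv_first₁] at h1i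
    refine (tendsto_eLpNorm_add (fun j => ?_) (fun j => ?_) (tendsto_eLpNorm_mul hC h1i)
      (tendsto_eLpNorm_mul hC' h0)).congr fun j => ?_
    · exact hθ.continuous.aestronglyMeasurable.mul
        ((continuous_fderiv_apply (hφ1 j) _).aestronglyMeasurable.sub
          (aestronglyMeasurable_weakDeriv _ _))
    · exact (continuous_fderiv_apply hθ _).aestronglyMeasurable.mul
        ((hφ j).continuous.aestronglyMeasurable.sub (aestronglyMeasurable_weakDeriv _ _))
    · congr 1 with x
      have h2 := (hθ.differentiable one_ne_zero x).hasFDerivAt.mul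
        ((hφ1 j).differentiable one_ne_zero x).hasFDerivAt
      have h3 : fderiv ℝ (fun x => θ x * φ j x) x = _ := h2.fderiv
      rw [h3]
      simp only [_root_.add_apply, _root_.smul_apply, smul_eq_mul,
        toL2]
      ring
  · refine hs.congr fun j => eLpNorm_congr_ae ?_
    filter_upwards [ae_restrict_mem isClosed_frontier.measurableSet] with x hx
    rw [hθ1 x hx, one_mul]

theorem aestronglyMeasurable_partialDeriv {φ : Space n → ℝ} (hφ : ContDiff ℝ ∞ φ)
    (a : DerivIndex n 1) (m : Measure (Space n)) :
    AEStronglyMeasurable (partialDeriv a.2 φ) m :=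
  (continuous_partialDeriv a.2 hφ).aestronglyMeasurable

theorem partialDeriv_add {φ φ' : Space n → ℝ} (hφ : ContDiff ℝ ∞ φ) (hφ' : ContDiff ℝ ∞ φ')
    (a : DerivIndex n 1) (x : Space n) :
    partialDeriv a.2 (fun x => φ x + φ' x) x = partialDeriv a.2 φ x + partialDeriv a.2 φ' x := by
  have h1 : ∀ {φ : Space n → ℝ}, ContDiff ℝ ∞ φ → ContDiffAt ℝ ((a.1 : ℕ) : ℕ∞) φ x :=
    fun h => (h.of_le (by exact_mod_cast le_top)).contDiffAt
  have h2 := iteratedFDeriv_add_apply (h1 hφ) (h1 hφ')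
  exact congrArg (fun T => T (fun j => EuclideanSpace.single (a.2 j) (1 : ℝ))) h2

theorem partialDeriv_const_mul {φ : Space n → ℝ} (hφ : ContDiff ℝ ∞ φ) (c : ℝ)
    (a : DerivIndex n 1) (x : Space n) :
    partialDeriv a.2 (fun x => c * φ x) x = c * partialDeriv a.2 φ x := by
  have h1 : ContDiffAt ℝ ((a.1 : ℕ) : ℕ∞) φ x := (hφ.of_le (by exact_mod_cast le_top)).contDiffAt
  have h2 := iteratedFDeriv_const_smul_apply (a := c) h1
  exact congrArg (fun T => T (fun j => EuclideanSpace.single (a.2 j) (1 : ℝ))) h2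

theorem HasTrace.add {u v : D.sobolev 1} {g g' : Space n → ℝ} (hu : HasTrace u g)
    (hv : HasTrace v g') : HasTrace (u + v) (fun x => g x + g' x) := by
  obtain ⟨hg, φ, hφ, h1, hs⟩ := hu
  obtain ⟨hg', φ', hφ', h1', hs'⟩ := hv
  refine ⟨hg.add hg', fun j x => φ j x + φ' j x, fun j => (hφ j).add (hφ' j), fun a => ?_, ?_⟩
  · refine (tendsto_eLpNorm_add (fun j => (aestronglyMeasurable_partialDeriv (hφ j) a _).sub
      (aestronglyMeasurable_weakDeriv u a)) (fun j => (aestronglyMeasurable_partialDeriv (hφ' j)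
      a _).sub (aestronglyMeasurable_weakDeriv v a)) (h1 a) (h1' a)).congr
      fun j => eLpNorm_congr_ae ?_
    filter_upwards [Lp.coeFn_add (weakDeriv u a) (weakDeriv v a)] with x hx
    have hx' : weakDeriv (u + v) a x = weakDeriv u a x + weakDeriv v a x := hx
    simp only [partialDeriv_add (hφ j) (hφ' j), hx', Pi.sub_apply]
    ring
  · refine (tendsto_eLpNorm_add
      (fun j => (hφ j).continuous.aestronglyMeasurable.sub hg.aestronglyMeasurable)
      (fun j => (hφ' j).continuous.aestronglyMeasurable.sub hg'.aestronglyMeasurable)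
      hs hs').congr fun j => ?_
    congr 1 with x
    simp only [Pi.sub_apply]
    ring

theorem HasTrace.const_smul {u : D.sobolev 1} {g : Space n → ℝ} (hu : HasTrace u g) (c : ℝ) :
    HasTrace (c • u) (fun x => c * g x) := by
  obtain ⟨hg, φ, hφ, h1, hs⟩ := hu
  refine ⟨hg.const_mul c, fun j x => c * φ j x, fun j => contDiff_const.mul (hφ j),
    fun a => ?_, ?_⟩
  · refine (tendsto_eLpNorm_mul (.of_forall fun _ => le_refl |c|) (h1 a)).congr
      fun j => eLpNorm_congr_ae ?_
    filter_upwards [Lp.coeFn_smul c (weakDeriv u a)] with x hx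
    have hx' : weakDeriv (c • u) a x = c * weakDeriv u a x := hx
    simp only [partialDeriv_const_mul (hφ j), hx']
    ring
  · refine (tendsto_eLpNorm_mul (.of_forall fun _ => le_refl |c|) hs).congr fun j => ?_
    congr 1 with x
    ring

theorem tendsto_eLpNorm_weakDeriv {k : ℕ} {v : ℕ → D.sobolev k} {u : D.sobolev k}
    (h : Tendsto v atTop (𝓝 u)) (a : DerivIndex n k) :
    Tendsto (fun j => eLpNorm (fun x => weakDeriv (v j) a x - weakDeriv u a x) 2 D.μ)
      atTop (𝓝 0) := by
  have h1 : Continuous fun u : D.sobolev k => weakDeriv u a :=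
    (PiLp.continuous_apply 2 _ a).comp continuous_subtype_val
  exact (Lp.tendsto_Lp_iff_tendsto_eLpNorm' _ _).1 ((h1.tendsto u).comp h)

/-- The trace relation is closed in `𝓗¹`, by a diagonal argument. -/
theorem HasTrace.of_tendsto {v : ℕ → D.sobolev 1} {u : D.sobolev 1} {g : Space n → ℝ}
    (hv : ∀ j, HasTrace (v j) g) (h : Tendsto v atTop (𝓝 u)) : HasTrace u g := by
  have key : ∀ j : ℕ, ∃ φ : Space n → ℝ, ContDiff ℝ ∞ φ ∧
      (∀ a : DerivIndex n 1, eLpNorm (fun x => partialDeriv a.2 φ x - weakDeriv (v j) a x) 2 D.μ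
        ≤ (j : ℝ≥0∞)⁻¹) ∧ eLpNorm (fun x => φ x - g x) 2 D.surface ≤ (j : ℝ≥0∞)⁻¹ := by
    intro j
    obtain ⟨-, φ, hφ, h1, hs⟩ := hv j
    have hpos : (0 : ℝ≥0∞) < (j : ℝ≥0∞)⁻¹ := ENNReal.inv_pos.2 (ENNReal.natCast_ne_top j)
    obtain ⟨i, hi, hi'⟩ := ((eventually_all.2 fun a =>
      (h1 a).eventually (ge_mem_nhds hpos)).and (hs.eventually (ge_mem_nhds hpos))).exists
    exact ⟨φ i, hφ i, hi, hi'⟩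
  choose φ hφ h1 hs using key
  refine ⟨(hv 0).1, φ, hφ, fun a => ?_, ?_⟩
  · exact tendsto_eLpNorm_sub_of_tendsto (f' := fun j => weakDeriv (v j) a)
      (fun j => aestronglyMeasurable_partialDeriv (hφ j) a _)
      (fun j => aestronglyMeasurable_weakDeriv _ _) (aestronglyMeasurable_weakDeriv _ _)
      (tendsto_of_tendsto_of_tendsto_of_le_of_le tendsto_const_nhds
        ENNReal.tendsto_inv_nat_nhds_zero (fun _ => zero_le) fun j => h1 j a)
      (tendsto_eLpNorm_weakDeriv h a)
  · exact tendsto_of_tendsto_of_tendsto_of_le_of_le tendsto_const_nhds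
      ENNReal.tendsto_inv_nat_nhds_zero (fun _ => zero_le) hs

variable (D) in
/-- The Sobolev functions of order one with zero boundary trace. -/
def zeroTrace : Submodule ℝ (D.sobolev 1) where
  carrier := {u | HasTrace u 0}
  zero_mem' := by
    refine ⟨MemLp.zero, fun _ _ => 0, fun _ => contDiff_const, fun a => ?_, ?_⟩
    · refine tendsto_const_nhds.congr fun j => Eq.symm ?_
      refine (eLpNorm_congr_ae (g := 0) ?_).trans eLpNorm_zero
      filter_upwards [Lp.coeFn_zero ℝ 2 D.μ] with x hx
      have hx' : weakDeriv (0 : D.sobolev 1) a x = 0 := hx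
      have h1 := partialDeriv_const_mul (n := n) (φ := fun _ => 0) contDiff_const 0 a x
      simp only [zero_mul] at h1
      simp only [h1, hx', sub_zero, Pi.zero_apply]
    · simp
  add_mem' hu hv := by simpa using! hu.add hv
  smul_mem' c u hu := by simpa using! hu.const_smul c

theorem isClosed_zeroTrace : IsClosed (zeroTrace D : Set (D.sobolev 1)) :=
  IsSeqClosed.isClosed fun _ _ hv h => HasTrace.of_tendsto hv h

/-- A curve in `𝓗¹` whose velocity has zero trace keeps its trace. -/
theorem HasTrace.of_hasDerivWithinAt {q q' : ℝ → D.sobolev 1} {g : Space n → ℝ}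
    (hq : ∀ t, 0 ≤ t → HasDerivWithinAt q (q' t) (Ici 0) t)
    (hq' : ∀ t, 0 ≤ t → HasTrace (q' t) 0) (h0 : HasTrace (q 0) g) {t : ℝ} (ht : 0 ≤ t) :
    HasTrace (q t) g := by
  have h2 : HasTrace (q t - q 0) 0 :=
    sub_mem_of_hasDerivWithinAt_mem (zeroTrace D) isClosed_zeroTrace hq hq' ht
  simpa using h0.add h2

/-- The inclusion `𝓗² ⊆ 𝓗¹` as a continuous linear map. -/
def toH1L (D : SampledDomain n) : D.sobolev 2 →L[ℝ] D.sobolev 1 where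
  toFun := toH1
  map_add' _ _ := rfl
  map_smul' _ _ := rfl
  cont := by
    refine Continuous.subtype_mk ((PiLp.continuous_toLp 2 _).comp (continuous_pi fun a => ?_)) _
    exact (PiLp.continuous_apply 2 _ (a.castLE one_le_two)).comp continuous_subtype_val

end SampledDomain

/-! ### The kernel and the limit dynamics -/

theorem IsActivation.exists_bound {σ : ℝ → ℝ} (hσ : IsActivation σ) :
    ∃ C : ℝ, 0 ≤ C ∧ ∀ x, |σ x| ≤ C ∧ |deriv σ x| ≤ C ∧ |deriv (deriv σ) x| ≤ C := by
  obtain ⟨C₀, h₀⟩ := hσ.smooth.2 0 (by norm_num)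
  obtain ⟨C₁, h₁⟩ := hσ.smooth.2 1 (by norm_num)
  obtain ⟨C₂, h₂⟩ := hσ.smooth.2 2 (by norm_num)
  simp only [norm_iteratedFDeriv_eq_norm_iteratedDeriv, iteratedDeriv_zero,
    iteratedDeriv_succ, Real.norm_eq_abs] at h₀ h₁ h₂
  refine ⟨max C₀ (max C₁ C₂), ((abs_nonneg _).trans (h₀ 0)).trans (le_max_left _ _), fun x =>
    ⟨(h₀ x).trans (le_max_left _ _), (h₁ x).trans ?_, (h₂ x).trans ?_⟩⟩
  · exact (le_max_left _ _).trans (le_max_right _ _)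
  · exact (le_max_right _ _).trans (le_max_right _ _)

theorem IsActivation.contDiff_one {σ : ℝ → ℝ} (hσ : IsActivation σ) : ContDiff ℝ 1 σ :=
  hσ.smooth.1.of_le (by norm_num)

theorem IsActivation.contDiff_one_deriv {σ : ℝ → ℝ} (hσ : IsActivation σ) :
    ContDiff ℝ 1 (deriv σ) := by
  have h : ContDiff ℝ (1 + 1) σ := hσ.smooth.1.of_le (by norm_num)
  exact ((contDiff_succ_iff_deriv (n := 1)).1 h).2.2

section Initialization

variable {S : Type*} [MeasurableSpace S] {P : Measure S} {c : S → ℝ} {w : S → Space n} {b : S → ℝ}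

theorem IsInitialization.integrable_norm_w [IsFiniteMeasure P] (h : IsInitialization P c w b) :
    Integrable (fun s => ‖w s‖) P := by
  have h1 : ∀ k, Integrable (fun s => |w s k|) P := by
    intro k
    refine ((integrable_const (1 : ℝ)).add (h.moment_w k)).mono'
      (Measurable.aestronglyMeasurable ?_) (.of_forall fun s => ?_)
    · exact ((EuclideanSpace.proj k : Space n →L[ℝ] ℝ).measurable.comp h.measurable_w).abs
    · simp only [Real.norm_eq_abs, abs_abs, Pi.add_apply]
      rcases le_total |w s k| 1 with h2 | h2
      · have := pow_nonneg (abs_nonneg (w s k)) 3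
        linarith
      · have := le_self_pow₀ h2 (n := 3) (by norm_num)
        linarith
  refine (integrable_finsetSum Finset.univ fun k _ => h1 k).mono'
    h.measurable_w.norm.aestronglyMeasurable (.of_forall fun s => ?_)
  rw [norm_norm]
  have h3 : w s = ∑ k, w s k • EuclideanSpace.single k (1 : ℝ) := by
    ext j
    simp [Finset.sum_apply, Pi.single_apply]
  calc ‖w s‖ = ‖∑ k, w s k • EuclideanSpace.single k (1 : ℝ)‖ := by rw [← h3]
    _ ≤ ∑ k, |w s k| := (norm_sum_le _ _).trans (le_of_eq (by simp [norm_smul]))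

end Initialization

namespace SampledDomain

variable {D : SampledDomain n} {η v : Space n → ℝ}

/-- The image of `𝓗²` under a Lipschitz operator that maps `0` into `L²` is contained in `L²`. -/
theorem IsLipschitzOperator.memLp {L : D.sobolev 2 → (Space n →ₘ[D.μ] ℝ)}
    (hL : IsLipschitzOperator L) (hL0 : MemLp (L 0) 2 D.μ) (u : D.sobolev 2) :
    MemLp (L u) 2 D.μ := by
  obtain ⟨C, hC⟩ := hL
  have hd : ∀ a, MemLp (fun x => |weakDeriv u a x - weakDeriv (0 : D.sobolev 2) a x|) 2 D.μ :=
    fun a => ((Lp.memLp (weakDeriv u a)).sub (Lp.memLp (weakDeriv (0 : D.sobolev 2) a))).norm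
  have hm : MemLp (fun x => C * (|toL2 u x - toL2 (0 : D.sobolev 2) x|
      + ∑ i, |weakDeriv u (.first i) x - weakDeriv (0 : D.sobolev 2) (.first i) x|
      + 1 / 2 * ∑ i, ∑ j, |weakDeriv u (.second i j) x -
        weakDeriv (0 : D.sobolev 2) (.second i j) x|)) 2 D.μ :=
    (((hd _).add (memLp_finsetSum _ fun i _ => hd _)).add
      ((memLp_finsetSum _ fun i _ => memLp_finsetSum _ fun j _ => hd _).const_mul _)).const_mul C
  have hdiff : MemLp (fun x => L u x - L 0 x) 2 D.μ := by
    refine hm.mono ((L u).aestronglyMeasurable.sub (L 0).aestronglyMeasurable) ?_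
    filter_upwards [hC u 0] with x hx
    exact hx.trans (le_abs_self _)
  convert hdiff.add hL0 using 1
  ext x
  simp

theorem memLp_continuous_mul (hη : Continuous η) (hv : MemLp v 2 D.μ) :
    MemLp (fun x => η x * v x) 2 D.μ := by
  obtain ⟨C, -, hC⟩ := D.exists_abs_le_of_continuous hη
  refine hv.of_le_mul (c := C) (hη.aestronglyMeasurable.mul hv.aestronglyMeasurable) ?_
  filter_upwards [hC] with x hx
  rw [norm_mul]
  exact mul_le_mul_of_nonneg_right hx (norm_nonneg _)

end SampledDomain

section Kernel

variable {S : Type*} [MeasurableSpace S] {P : Measure S} [IsProbabilityMeasure P]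
  {ν : Measure (Space n)}
  {c : S → ℝ} {w : S → Space n} {b : S → ℝ} {σ : ℝ → ℝ} {h : Space n → ℝ} {R : ℝ}

theorem inner_eq_sum_mul (x y : Space n) : ⟪x, y⟫ = ∑ i, x i * y i := by
  simp [PiLp.inner_apply, mul_comm]

theorem measurable_comp_inner_add {τ : ℝ → ℝ} (hτ : Continuous τ) {Z : Type*}
    [MeasurableSpace Z] {W X : Z → Space n} {β : Z → ℝ} (hW : Measurable W) (hX : Measurable X)
    (hβ : Measurable β) : Measurable fun z => τ (⟪W z, X z⟫ + β z) :=
  hτ.measurable.comp ((hW.inner hX).add hβ)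

theorem measurable_coord {Z : Type*} [MeasurableSpace Z] {X : Z → Space n} (hX : Measurable X)
    (i : Fin n) : Measurable fun z => X z i :=
  (EuclideanSpace.proj i : Space n →L[ℝ] ℝ).measurable.comp hX

theorem ae_prod_of_ae_left {X Y : Type*} [MeasurableSpace X] [MeasurableSpace Y] {m : Measure X}
    {m' : Measure Y} [SFinite m'] {p : X → Prop} (hp : ∀ᵐ x ∂m, p x) :
    ∀ᵐ z ∂m.prod m', p z.1 :=
  Measure.quasiMeasurePreserving_fst.ae hp

theorem ae_prod_of_ae_right {X Y : Type*} [MeasurableSpace X] [MeasurableSpace Y] {m : Measure X}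
    {m' : Measure Y} [SFinite m'] {p : Y → Prop} (hp : ∀ᵐ y ∂m', p y) :
    ∀ᵐ z ∂m.prod m', p z.2 :=
  Measure.quasiMeasurePreserving_snd.ae hp

theorem abs_coord_le (x : Space n) (i : Fin n) : |x i| ≤ ‖x‖ := PiLp.norm_apply_le x i

/-- The ridge averages that make up the functions `y ↦ ∫ h(x) A(x, y) dν(x)`; the variable of
integration is the pair of a point `x` and an outcome `s`. -/
theorem integrable_and_contDiff_integral_ridge (hinit : IsInitialization P c w b)
    (hh : Integrable h ν) {q : Space n × S → ℝ} (hq : Measurable q) {M : ℝ}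
    (hM : ∀ᵐ z ∂ν.prod P, |q z| ≤ M) {τ : ℝ → ℝ} (hτ : ContDiff ℝ 1 τ) {C : ℝ}
    (hC₀ : ∀ x, |τ x| ≤ C) (hC₁ : ∀ x, |deriv τ x| ≤ C) :
    (∀ y : Space n, Integrable (fun z => h z.1 * q z * τ (⟪w z.2, y⟫ + b z.2)) (ν.prod P)) ∧
    ContDiff ℝ 1 fun y : Space n =>
      ∫ z, h z.1 * q z * τ (⟪w z.2, y⟫ + b z.2) ∂ν.prod P := by
  have hp : Integrable (fun z : Space n × S => h z.1 * q z) (ν.prod P) :=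
    (hh.comp_fst P).mul_bdd hq.aestronglyMeasurable hM
  have hw : Measurable fun z : Space n × S => w z.2 := hinit.measurable_w.comp measurable_snd
  have hb : Measurable fun z : Space n × S => b z.2 := hinit.measurable_b.comp measurable_snd
  refine ⟨fun y => hp.mul_bdd (measurable_comp_inner_add hτ.continuous hw measurable_const
    hb).aestronglyMeasurable (.of_forall fun z => hC₀ _), contDiff_integral_ridge hp
    hw.aestronglyMeasurable hb.aestronglyMeasurable ?_ hτ hC₀ hC₁⟩
  refine ((hh.norm.mul_prod hinit.integrable_norm_w).mul_bdd hq.norm.aestronglyMeasurable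
    (c := M) (by simpa using hM)).congr (.of_forall fun z => ?_)
  simp only [norm_mul]
  ring

theorem contDiff_one_integral_kernelA [SFinite ν] (hσ : IsActivation σ)
    (hinit : IsInitialization P c w b)
    (hR : ∀ᵐ x ∂ν, ‖x‖ ≤ R) (hh : Integrable h ν) :
    ContDiff ℝ 1 fun y => ∫ x, h x * kernelA P σ c w b x y ∂ν := by
  obtain ⟨C, hC0, hC⟩ := hσ.exists_bound
  obtain ⟨K, hK⟩ := hinit.bounded_c
  have hw : Measurable fun z : Space n × S => w z.2 := hinit.measurable_w.comp measurable_snd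
  have hb : Measurable fun z : Space n × S => b z.2 := hinit.measurable_b.comp measurable_snd
  have hc : Measurable fun z : Space n × S => c z.2 := hinit.measurable_c.comp measurable_snd
  have hA := measurable_comp_inner_add hσ.contDiff_one.continuous hw measurable_fst hb
  have hA' := measurable_comp_inner_add hσ.contDiff_one_deriv.continuous hw measurable_fst hb
  have hcA : ∀ᵐ z ∂ν.prod P, |c z.2 ^ 2 * deriv σ (⟪w z.2, z.1⟫ + b z.2)| ≤ K ^ 2 * C := by
    filter_upwards [ae_prod_of_ae_right hK] with z hz
    rw [abs_mul, abs_pow]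
    exact mul_le_mul (pow_le_pow_left₀ (abs_nonneg _) hz.le 2) (hC _).2.1 (abs_nonneg _)
      (sq_nonneg _)
  obtain ⟨hi₁, hd₁⟩ := integrable_and_contDiff_integral_ridge hinit hh hA
    (.of_forall fun z => (hC _).1) hσ.contDiff_one (fun x => (hC x).1) (fun x => (hC x).2.1)
  obtain ⟨hi₂, hd₂⟩ := integrable_and_contDiff_integral_ridge hinit hh ((hc.pow_const 2).mul hA')
    hcA hσ.contDiff_one_deriv (fun x => (hC x).2.1) (fun x => (hC x).2.2)
  have h₃ := fun i => integrable_and_contDiff_integral_ridge hinit hh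
    (((hc.pow_const 2).mul hA').mul (measurable_coord measurable_fst i)) (M := K ^ 2 * C * R) (by
      filter_upwards [hcA, ae_prod_of_ae_left hR] with z hz hz'
      simp only [Pi.mul_apply]
      rw [abs_mul]
      exact mul_le_mul hz ((abs_coord_le _ i).trans hz') (abs_nonneg _) (by positivity))
    hσ.contDiff_one_deriv (fun x => (hC x).2.1) (fun x => (hC x).2.2)
  simp only [Pi.mul_apply] at hi₂ hd₂ h₃
  have hsum : ∀ y : Space n, Integrable (fun z : Space n × S => ∑ i, y i *
      (h z.1 * (c z.2 ^ 2 * deriv σ (⟪w z.2, z.1⟫ + b z.2) * z.1 i) *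
        deriv σ (⟪w z.2, y⟫ + b z.2))) (ν.prod P) := fun y =>
    integrable_finsetSum _ fun i _ => ((h₃ i).1 y).const_mul _
  have hcoord : ∀ i, ContDiff ℝ 1 fun y : Space n => y i := fun i =>
    (EuclideanSpace.proj i : Space n →L[ℝ] ℝ).contDiff
  convert (hd₁.add (ContDiff.sum fun i (_ : i ∈ Finset.univ) =>
    (hcoord i).mul (h₃ i).2)).add hd₂ using 2 with y
  have key : ∀ x s, h x * (σ (⟪w s, x⟫ + b s) * σ (⟪w s, y⟫ + b s)
      + c s ^ 2 * deriv σ (⟪w s, x⟫ + b s) * deriv σ (⟪w s, y⟫ + b s) * (⟪x, y⟫ + 1)) =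
      h x * σ (⟪w s, x⟫ + b s) * σ (⟪w s, y⟫ + b s) +
      ∑ i, y i * (h x * (c s ^ 2 * deriv σ (⟪w s, x⟫ + b s) * x i) * deriv σ (⟪w s, y⟫ + b s)) +
      h x * (c s ^ 2 * deriv σ (⟪w s, x⟫ + b s)) * deriv σ (⟪w s, y⟫ + b s) := by
    intro x s
    have h1 : ∑ i, y i * (h x * (c s ^ 2 * deriv σ (⟪w s, x⟫ + b s) * x i) *
        deriv σ (⟪w s, y⟫ + b s)) = h x * (c s ^ 2 * deriv σ (⟪w s, x⟫ + b s)) *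
        deriv σ (⟪w s, y⟫ + b s) * ⟪x, y⟫ := by
      rw [inner_eq_sum_mul x y, Finset.mul_sum]
      refine Finset.sum_congr rfl fun i _ => ?_
      ring
    rw [h1]
    ring
  simp only [kernelA, ← integral_const_mul, key]
  have hint := (hi₁ y).add (hsum y) |>.add (hi₂ y)
  refine (integral_prod _ hint).symm.trans ?_
  rw [integral_add' ((hi₁ y).add (hsum y)) (hi₂ y), integral_add' (hi₁ y) (hsum y),
    integral_finsetSum _ fun i _ => ((h₃ i).1 y).const_mul _]

/-- The quadratic form of the kernel `A`, as an average of squares. -/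
theorem integral_mul_integral_kernelA [SFinite ν] (hσ : IsActivation σ)
    (hinit : IsInitialization P c w b)
    (hR : ∀ᵐ x ∂ν, ‖x‖ ≤ R) (hR0 : 0 ≤ R) (hh : Integrable h ν) :
    Integrable (fun s => (∫ x, h x * σ (⟪w s, x⟫ + b s) ∂ν) ^ 2
      + c s ^ 2 * (∑ i, (∫ x, h x * (deriv σ (⟪w s, x⟫ + b s) * x i) ∂ν) ^ 2
        + (∫ x, h x * deriv σ (⟪w s, x⟫ + b s) ∂ν) ^ 2)) P ∧
    ∫ y, h y * ∫ x, h x * kernelA P σ c w b x y ∂ν ∂ν =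
      ∫ s, ((∫ x, h x * σ (⟪w s, x⟫ + b s) ∂ν) ^ 2
        + c s ^ 2 * (∑ i, (∫ x, h x * (deriv σ (⟪w s, x⟫ + b s) * x i) ∂ν) ^ 2
          + (∫ x, h x * deriv σ (⟪w s, x⟫ + b s) ∂ν) ^ 2)) ∂P := by
  obtain ⟨C, hC0, hC⟩ := hσ.exists_bound
  obtain ⟨K, hK⟩ := hinit.bounded_c
  let F : Space n × Space n → S → ℝ := fun z s => h z.1 * h z.2 *
    (σ (⟪w s, z.2⟫ + b s) * σ (⟪w s, z.1⟫ + b s)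
      + c s ^ 2 * deriv σ (⟪w s, z.2⟫ + b s) * deriv σ (⟪w s, z.1⟫ + b s) * (⟪z.2, z.1⟫ + 1))
  have hF : Integrable (Function.uncurry F) ((ν.prod ν).prod P) := by
    have hw : Measurable fun z : (Space n × Space n) × S => w z.2 :=
      hinit.measurable_w.comp measurable_snd
    have hb : Measurable fun z : (Space n × Space n) × S => b z.2 :=
      hinit.measurable_b.comp measurable_snd
    have hc : Measurable fun z : (Space n × Space n) × S => c z.2 :=
      hinit.measurable_c.comp measurable_snd
    have hy : Measurable fun z : (Space n × Space n) × S => z.1.1 := by fun_prop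
    have hx : Measurable fun z : (Space n × Space n) × S => z.1.2 := by fun_prop
    have hσc := hσ.contDiff_one.continuous
    have hσc' := hσ.contDiff_one_deriv.continuous
    refine ((hh.mul_prod hh).comp_fst P).mul_bdd (c := C * C + K ^ 2 * C * C * (R * R + 1))
      (Measurable.aestronglyMeasurable ?_) ?_
    · exact ((measurable_comp_inner_add hσc hw hx hb).mul
        (measurable_comp_inner_add hσc hw hy hb)).add
        ((((hc.pow_const 2).mul (measurable_comp_inner_add hσc' hw hx hb)).mul
        (measurable_comp_inner_add hσc' hw hy hb)).mul ((hx.inner hy).add_const 1))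
    · filter_upwards [ae_prod_of_ae_right hK, ae_prod_of_ae_left (ae_prod_of_ae_left hR),
        ae_prod_of_ae_left (ae_prod_of_ae_right hR)] with z hz hz1 hz2
      have h1 : |c z.2| ^ 2 ≤ K ^ 2 := pow_le_pow_left₀ (abs_nonneg _) hz.le 2
      have h2 : |⟪z.1.2, z.1.1⟫ + 1| ≤ R * R + 1 := by
        refine (abs_add_le _ _).trans ?_
        rw [abs_one]
        gcongr
        exact (abs_real_inner_le_norm _ _).trans (by gcongr)
      refine (norm_add_le _ _).trans ?_
      simp only [Real.norm_eq_abs, abs_mul, abs_pow]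
      have := fun t => (hC t).1
      have := fun t => (hC t).2.1
      gcongr <;> apply_assumption
  have hinner : ∀ s, ∫ z, F z s ∂ν.prod ν = (∫ x, h x * σ (⟪w s, x⟫ + b s) ∂ν) ^ 2
      + c s ^ 2 * (∑ i, (∫ x, h x * (deriv σ (⟪w s, x⟫ + b s) * x i) ∂ν) ^ 2
        + (∫ x, h x * deriv σ (⟪w s, x⟫ + b s) ∂ν) ^ 2) := by
    intro s
    have hm := fun {τ : ℝ → ℝ} (hτ : Continuous τ) => measurable_comp_inner_add hτ
      (measurable_const (a := w s)) measurable_id (measurable_const (a := b s))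
    have i₁ : Integrable (fun x => h x * σ (⟪w s, x⟫ + b s)) ν :=
      hh.mul_bdd (hm hσ.contDiff_one.continuous).aestronglyMeasurable
        (.of_forall fun x => (hC _).1)
    have i₂ : Integrable (fun x => h x * deriv σ (⟪w s, x⟫ + b s)) ν :=
      hh.mul_bdd (hm hσ.contDiff_one_deriv.continuous).aestronglyMeasurable
        (.of_forall fun x => (hC _).2.1)
    have i₃ : ∀ i, Integrable (fun x => h x * (deriv σ (⟪w s, x⟫ + b s) * x i)) ν := by
      intro i
      refine (i₂.mul_bdd (c := R) (measurable_coord measurable_id i).aestronglyMeasurable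
        ?_).congr (.of_forall fun x => mul_assoc _ _ _)
      filter_upwards [hR] with x hx using (abs_coord_le x i).trans hx
    have key : ∀ z, F z s =
        (h z.1 * σ (⟪w s, z.1⟫ + b s)) * (h z.2 * σ (⟪w s, z.2⟫ + b s)) +
        c s ^ 2 * (∑ i, (h z.1 * (deriv σ (⟪w s, z.1⟫ + b s) * z.1 i)) *
            (h z.2 * (deriv σ (⟪w s, z.2⟫ + b s) * z.2 i)) +
          (h z.1 * deriv σ (⟪w s, z.1⟫ + b s)) * (h z.2 * deriv σ (⟪w s, z.2⟫ + b s))) := by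
      intro z
      have h1 : ∑ i, (h z.1 * (deriv σ (⟪w s, z.1⟫ + b s) * z.1 i)) *
          (h z.2 * (deriv σ (⟪w s, z.2⟫ + b s) * z.2 i)) =
          (h z.1 * deriv σ (⟪w s, z.1⟫ + b s)) * (h z.2 * deriv σ (⟪w s, z.2⟫ + b s)) *
            ⟪z.2, z.1⟫ := by
        rw [inner_eq_sum_mul z.2 z.1, Finset.mul_sum]
        refine Finset.sum_congr rfl fun i _ => ?_
        ring
      rw [h1]
      ring
    have hsum := integrable_finsetSum Finset.univ fun i _ => (i₃ i).mul_prod (i₃ i)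
    simp only [key]
    rw [integral_add (i₁.mul_prod i₁) ((hsum.fun_add (i₂.mul_prod i₂)).const_mul _),
      integral_const_mul, integral_add hsum (i₂.mul_prod i₂),
      integral_finsetSum _ fun i _ => (i₃ i).mul_prod (i₃ i),
      integral_prod_mul (μ := ν) (ν := ν) (fun x => h x * σ (⟪w s, x⟫ + b s))
        (fun x => h x * σ (⟪w s, x⟫ + b s)),
      integral_prod_mul (μ := ν) (ν := ν) (fun x => h x * deriv σ (⟪w s, x⟫ + b s))
        (fun x => h x * deriv σ (⟪w s, x⟫ + b s)), ← sq, ← sq]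
    congr 3
    refine Finset.sum_congr rfl fun i _ => ?_
    rw [integral_prod_mul (μ := ν) (ν := ν) (fun x => h x * (deriv σ (⟪w s, x⟫ + b s) * x i))
        (fun x => h x * (deriv σ (⟪w s, x⟫ + b s) * x i)), ← sq]
  simp only [← hinner]
  refine ⟨hF.integral_prod_right, ?_⟩
  rw [← integral_integral_swap hF]
  refine Eq.trans ?_ (integral_prod _ hF.integral_prod_left).symm
  simp only [kernelA, F, Function.uncurry_apply_pair, mul_assoc, integral_const_mul]

/-- The quadratic form of the kernel `A` is definite: if it vanishes at `h`, then so does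
`∫ h(x) σ(⟪w, x⟫ + b) dν` for all `w` and `b`, and `σ` is discriminatory. -/
theorem ae_eq_zero_of_integral_mul_integral_kernelA_eq_zero [SFinite ν] (hσ : IsActivation σ)
    (hinit : IsInitialization P c w b) (hR : ∀ᵐ x ∂ν, ‖x‖ ≤ R) (hR0 : 0 ≤ R)
    (hh : Integrable h ν) (h0 : ∫ y, h y * ∫ x, h x * kernelA P σ c w b x y ∂ν ∂ν = 0) :
    h =ᵐ[ν] 0 := by
  obtain ⟨C, hC0, hC⟩ := hσ.exists_bound
  have hσc := hσ.contDiff_one.continuous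
  obtain ⟨hint, heq⟩ := integral_mul_integral_kernelA hσ hinit hR hR0 hh
  rw [heq, integral_eq_zero_iff_of_nonneg (fun s => by positivity) hint] at h0
  let J : Space n × ℝ → ℝ := fun p => ∫ x, h x * σ (⟪p.1, x⟫ + p.2) ∂ν
  have hJ : Continuous J := by
    refine continuous_of_dominated (bound := fun x => ‖h x‖ * C) (fun p =>
      hh.aestronglyMeasurable.mul (hσc.comp (by fun_prop)).aestronglyMeasurable)
      (fun p => .of_forall fun x => ?_) (hh.norm.mul_const C) (.of_forall fun x =>
      continuous_const.mul (hσc.comp (by fun_prop)))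
    rw [norm_mul]
    exact mul_le_mul_of_nonneg_left (hC _).1 (norm_nonneg _)
  have hJs : ∀ᵐ s ∂P, J (w s, b s) = 0 := by
    filter_upwards [h0] with s hs
    have h1 : 0 ≤ c s ^ 2 * (∑ i, (∫ x, h x * (deriv σ (⟪w s, x⟫ + b s) * x i) ∂ν) ^ 2
        + (∫ x, h x * deriv σ (⟪w s, x⟫ + b s) ∂ν) ^ 2) := by positivity
    have h2 := ((add_eq_zero_iff_of_nonneg (sq_nonneg _) h1).1 hs).1
    exact pow_eq_zero_iff two_ne_zero |>.1 h2
  -- A non-empty open set on which `J ≠ 0` would be charged by the law of `(w, b)`.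
  have hJ0 : ∀ p, J p = 0 := by
    by_contra! hne
    exact (hinit.full_support {p | J p ≠ 0} (isOpen_ne_fun hJ continuous_const) hne).ne' hJs
  exact ae_eq_zero_of_forall_integral_mul_ridge_eq_zero hh hR hσc (fun x => (hC x).1)
    hσ.nonconstant fun w b => hJ0 (w, b)

end Kernel

namespace SampledDomain

variable {D : SampledDomain n} {S : Type*} [MeasurableSpace S] {P : Measure S}
  {c : S → ℝ} {w : S → Space n} {b : S → ℝ} {σ : ℝ → ℝ} {η v : Space n → ℝ}

theorem integralOp_kernelB (y : Space n) :
    D.integralOp (kernelB P σ c w b η) v y =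
      η y * ∫ x, η x * v x * kernelA P σ c w b x y ∂D.μ := by
  rw [integralOp, ← integral_const_mul]
  congr 1 with x
  rw [kernelB]
  ring

theorem ae_eq_zero_of_integralOp_kernelB_eq_zero [IsProbabilityMeasure P]
    (hη : D.IsAuxiliary η) (hσ : IsActivation σ)
    (hinit : IsInitialization P c w b) (hv : MemLp v 2 D.μ)
    (h0 : ∀ᵐ y ∂D.μ, D.integralOp (kernelB P σ c w b η) v y = 0) : ∀ᵐ x ∂D.μ, v x = 0 := by
  obtain ⟨R, hR0, hR⟩ := D.exists_ae_norm_le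
  have hh : Integrable (fun x => η x * v x) D.μ :=
    (memLp_continuous_mul hη.smooth.1.continuous hv).integrable one_le_two
  have h1 := ae_eq_zero_of_integral_mul_integral_kernelA_eq_zero hσ hinit hR hR0 hh ?_
  · filter_upwards [h1, D.ae_mem_carrier] with x hx hxD
    exact (mul_eq_zero.1 hx).resolve_left (hη.mem_Ioo x hxD).1.ne'
  · refine integral_eq_zero_of_ae ?_
    filter_upwards [h0] with y hy
    rw [integralOp_kernelB] at hy
    rw [Pi.zero_apply, mul_right_comm, hy, zero_mul]

/-- At a fixed point `q` the operator `𝓑` annihilates `L q`, and `𝓑` is injective on `L²`. -/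
theorem IsFixedPoint.ae_eq_zero [IsProbabilityMeasure P] {L : D.sobolev 2 → (Space n →ₘ[D.μ] ℝ)}
    (hL : IsLipschitzOperator L) (hL0 : MemLp (L 0) 2 D.μ) (hη : D.IsAuxiliary η)
    (hσ : IsActivation σ) (hinit : IsInitialization P c w b) {α : ℝ} (hα : 0 < α)
    {q : D.sobolev 2} (hq : IsFixedPoint α (kernelB P σ c w b η) L q) :
    ∀ᵐ x ∂D.μ, L q x = 0 := by
  obtain ⟨q', hd, hq'⟩ := hq 0 le_rfl
  have h0 : q' = 0 := (uniqueDiffWithinAt_Ici (0 : ℝ)).eq_deriv _ hd (hasDerivWithinAt_const _ _ _)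
  subst h0
  refine ae_eq_zero_of_integralOp_kernelB_eq_zero hη hσ hinit (hL.memLp hL0 q) ?_
  filter_upwards [hq', Lp.coeFn_zero ℝ 2 D.μ] with y hy hy0
  have h1 : toL2 (0 : D.sobolev 2) y = 0 := hy0
  rw [h1] at hy
  exact (mul_eq_zero.1 hy.symm).resolve_left hα.ne'

/-- The limit dynamics start at `(1 - η) f`, which has the trace of `f`, and preserve the trace:
each velocity `α 𝓑(L Q_s)` is `η` times a `C¹` function, so it has zero trace. -/
theorem IsWideNetworkLimit.hasTrace [IsProbabilityMeasure P] [IsFiniteMeasure D.surface]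
    {L : D.sobolev 2 → (Space n →ₘ[D.μ] ℝ)} (hL : IsLipschitzOperator L)
    (hL0 : MemLp (L 0) 2 D.μ) (hη : D.IsAuxiliary η) (hσ : IsActivation σ)
    (hinit : IsInitialization P c w b) {α : ℝ} {f : D.sobolev 2} {g : Space n → ℝ}
    (hf : HasTrace (toH1 f) g) {q : ℝ → D.sobolev 2}
    (hq : IsWideNetworkLimit α (kernelB P σ c w b η) L η f q) {t : ℝ} (ht : 0 ≤ t) :
    HasTrace (toH1 (q t)) g := by
  obtain ⟨hq0, hode⟩ := hq
  choose! q' hd hq' using hode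
  have hη1 : ContDiff ℝ 1 η := hη.smooth.1.of_le (by norm_num)
  obtain ⟨R, hR0, hR⟩ := D.exists_ae_norm_le
  refine HasTrace.of_hasDerivWithinAt (q := fun s => toH1 (q s)) (q' := fun s => toH1 (q' s))
    (fun s hs => (toH1L D).hasFDerivAt.comp_hasDerivWithinAt s (hd s hs)) (fun s hs => ?_)
    (hf.mul_of_eq_one (θ := fun y => 1 - η y) (contDiff_const.sub hη1)
      (fun x hx => by simp [hη.eq_zero x hx]) hq0) ht
  have hh : Integrable (fun x => η x * L (q s) x) D.μ :=
    (memLp_continuous_mul hη1.continuous (hL.memLp hL0 (q s))).integrable one_le_two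
  refine hasTrace_of_contDiff_one (G := fun y => α * (η y *
    ∫ x, η x * L (q s) x * kernelA P σ c w b x y ∂D.μ)) (contDiff_const.mul (hη1.mul
    (contDiff_one_integral_kernelA hσ hinit hR hh))) ?_ (fun x hx => ?_) MemLp.zero
  · filter_upwards [hq' s hs] with y hy
    rw [← integralOp_kernelB]
    exact hy
  · simp [hη.eq_zero x hx]

end SampledDomain

end QPDE

end

theorem mainTheorem3 {n : ℕ} (hn : 1 ≤ n) (D : QPDE.SampledDomain n)
    (a : ℝ≥0) (ha0 : 0 < a) (ha1 : a < 1) (hbd : QPDE.HasHolderBoundary D.carrier 3 a)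
    (L : D.sobolev 2 → (QPDE.Space n →ₘ[D.μ] ℝ))
    (hL : QPDE.SampledDomain.IsLipschitzOperator L) (hL0 : MemLp (L 0) 2 D.μ)
    (η : QPDE.Space n → ℝ) (hη : D.IsAuxiliary η)
    (fbd : QPDE.Space n → ℝ) (f : D.sobolev 2)
    (hf : QPDE.SampledDomain.HasTrace (QPDE.SampledDomain.toH1 f) fbd)
    (σ : ℝ → ℝ) (hσ : QPDE.IsActivation σ)
    {S : Type*} [MeasurableSpace S] (P : Measure S) [IsProbabilityMeasure P]
    (c : S → ℝ) (w : S → QPDE.Space n) (b : S → ℝ) (hinit : QPDE.IsInitialization P c w b)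
    (α : ℝ) (hα : 0 < α)
    (Qt : ℝ → D.sobolev 2)
    (hQt : QPDE.SampledDomain.IsWideNetworkLimit α (QPDE.kernelB P σ c w b η) L η f Qt)
    (Q : D.sobolev 2)
    (hQ : QPDE.SampledDomain.IsFixedPoint α (QPDE.kernelB P σ c w b η) L Q)
    (hconv : Tendsto (fun t => QPDE.SampledDomain.toH1 (Qt t)) atTop
      (𝓝 (QPDE.SampledDomain.toH1 Q))) :
    QPDE.SampledDomain.IsSolution L fbd Q := by
  have hfin : IsFiniteMeasure D.surface := by
    refine ⟨?_⟩
    rw [QPDE.SampledDomain.surface, Measure.restrict_apply_univ]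
    exact hbd.hausdorffMeasure_frontier_lt_top D.isOpen D.isBounded (by norm_num)
  refine ⟨hQ.ae_eq_zero hL hL0 hη hσ hinit hα, ?_⟩
  exact QPDE.SampledDomain.HasTrace.of_tendsto
    (fun j : ℕ => hQt.hasTrace hL hL0 hη hσ hinit hf j.cast_nonneg)
    (hconv.comp tendsto_natCast_atTop_atTop)
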